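/- **Setting.** Let $\Phi$ be a finite reduced crystallographic root system with a fixed choice of simple roots, $W$ its Weyl group, $S$ the set of simple reflections, $e$ the identity, $\ell$ the length function of $W$ with respect to $S$, $w_{\mathrm o}$ the longest element of $W$, $N=\ell(w_{\mathrm o})$, and $T=\{wsw^{-1}: w\in W,\ s\in S\}$ the set of reflections. For $\tau\in T$ let $\alpha_\tau$ be the corresponding positive root and $\mathrm{ht}(\alpha_\tau)$ its height, i.e. the sum of its coefficients in the basis of simple roots. A *reflection subgroup* $W'\subseteq W$ is a subgroup generated by a subset of $T$; the positive roots whose reflections lie in $W'$ are the positive roots of a root subsystem, and the *canonical generators* of $W'$ are the reflections in the simple roots of this subsystem. $W'$ is *dihedral* if it has exactly two canonical generators. A *reflection ordering* is a bijection $\varphi:T\to\{1,\dots,N\}$ such that, for every dihedral reflection subgroup with canonical generators $a,b$, the sequence $\varphi(a),\varphi(aba),\varphi(ababa),\dots,\varphi(babab),\varphi(bab),\varphi(b)$ is either increasing or decreasing. Let $D(W)$ be the directed graph with vertex set $W$ in which, for $u\in W$ and $\tau\in T$, there is an edge from $u$ to $\tau u$ if either $\ell(\tau u)=\ell(u)+1$,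 or $\ell(\tau u)=\ell(u)-\ell(\tau)$ and $\ell(\tau)=2\,\mathrm{ht}(\alpha_\tau)-1$. This edge is labelled by $\varphi(\tau)$. Let $\ell(u,v)$ denote the length of a shortest path from $u$ to $v$ in $D(W)$. Let $k$ be a field of characteristic $0$ and $\varepsilon$ a formal variable. For $\tau\in T$ let $Q_\tau$ be the linear operator on the span of $W$ over $k[\varepsilon]$ with $Q_\tau(w)=\tau w$ if $D(W)$ has an edge from $w$ to $\tau w$ and $Q_\tau(w)=0$ otherwise, and put $R_\tau=1+\varepsilon Q_\tau$. **Theorem.** Fix a reflection ordering $\varphi$. 1. For all $u,v\in W$ there is a unique path from $u$ to $v$ in $D(W)$ whose sequence of labels is strictly increasing, and a unique path from $u$ to $v$ whose sequence of labels is strictly decreasing. 2. The unique label-increasing (resp. label-decreasing) path from $u$ to $v$ has the smallest possible length $\ell(u,v)$. Moreover, its label sequence is lexicographically minimal (resp. lexicographically maximal) among the label sequences of all shortest paths from $u$ to $v$. 3. For every $u\in W$, $$R_{\varphi^{-1}(1)}\cdots R_{\varphi^{-1}(N)}(u)=\sum_{v\in W}\varepsilon^{\ell(u,v)}\,v .$$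 -/

import Mathlib

noncomputable section

namespace QuantumBruhat

variable {ι M N : Type*} [AddCommGroup M] [Module ℝ M] [AddCommGroup N] [Module ℝ N]
  {P : RootPairing ι ℝ M N} (b : P.Base)

/-- The Weyl group of a finite root system is finite. -/
instance finite_weylGroup [Finite ι] [P.IsRootSystem] : Finite P.weylGroup := by
  refine Finite.of_injective P.weylGroupToPerm fun g h hgh ↦ Subtype.ext ?_
  refine RootPairing.Equiv.weightHom_injective P (LinearEquiv.toLinearMap_injective ?_)
  refine LinearMap.ext_on (RootPairing.IsRootSystem.span_root_eq_top (P := P)) ?_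
  rintro _ ⟨i, rfl⟩
  have := P.weylGroup_apply_root g i
  rw [hgh, ← P.weylGroup_apply_root h i] at this
  exact this

/-- The simple reflections of the Weyl group attached to the base `b`. -/
def simpleReflections : Set P.weylGroup :=
  {s | ∃ i ∈ b.support, s = RootPairing.weylGroup.ofIdx P i}

/-- The length of `w`: the smallest number of factors in an expansion of `w` as a product of
simple reflections. -/
def len (w : P.weylGroup) : ℕ :=
  sInf {n | ∃ l : List P.weylGroup, (∀ s ∈ l, s ∈ simpleReflections b) ∧ l.prod = w ∧ l.length = n}

/-- The set of reflections: all conjugates of simple reflections. -/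
def reflections : Set P.weylGroup :=
  {t | ∃ w : P.weylGroup, ∃ s ∈ simpleReflections b, t = w * s * w⁻¹}

/-- The positive roots (given by their indices) whose reflections lie in the subgroup `H`. -/
def posRootsOf (H : Subgroup P.weylGroup) : Set ι :=
  {i | b.IsPos i ∧ RootPairing.weylGroup.ofIdx P i ∈ H}

/-- The canonical generators of a reflection subgroup `H`: the reflections in the simple roots of
its root subsystem, that is, in those positive roots of the subsystem that are not the sum of two
positive roots of the subsystem. -/
def canonicalGenerators (H : Subgroup P.weylGroup) : Set P.weylGroup :=
  {t | ∃ i ∈ posRootsOf b H,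
    (∀ j ∈ posRootsOf b H, ∀ k ∈ posRootsOf b H, P.root i ≠ P.root j + P.root k) ∧
    t = RootPairing.weylGroup.ofIdx P i}

/-- A reflection subgroup is a subgroup generated by a set of reflections. -/
def IsReflectionSubgroup (H : Subgroup P.weylGroup) : Prop :=
  ∃ A ⊆ reflections b, H = Subgroup.closure A

lemma mul_self_of_mem_reflections {t : P.weylGroup} (ht : t ∈ reflections b) : t * t = 1 := by
  obtain ⟨w, s, ⟨i, -, rfl⟩, rfl⟩ := ht
  have h : RootPairing.weylGroup.ofIdx P i * RootPairing.weylGroup.ofIdx P i = 1 := by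
    apply Subtype.ext
    change RootPairing.Equiv.reflection P i * RootPairing.Equiv.reflection P i = 1
    rw [mul_eq_one_iff_inv_eq, RootPairing.Equiv.reflection_inv P i]
  calc _ = w * (RootPairing.weylGroup.ofIdx P i * RootPairing.weylGroup.ofIdx P i) * w⁻¹ := by group
    _ = 1 := by rw [h]; group

lemma conj_mem_reflections {t : P.weylGroup} (ht : t ∈ reflections b) (w : P.weylGroup) :
    w * t * w⁻¹ ∈ reflections b := by
  obtain ⟨v, s, hs, rfl⟩ := ht
  exact ⟨w * v, s, hs, by group⟩

lemma alternating_mem {s t : P.weylGroup} (hs : s ∈ reflections b) (ht : t ∈ reflections b)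
    (k : ℕ) : (s * t) ^ k * s ∈ reflections b := by
  induction k using Nat.twoStepInduction with
  | zero => simpa using hs
  | one =>
    have h := conj_mem_reflections b ht s
    rw [inv_eq_of_mul_eq_one_left (mul_self_of_mem_reflections b hs)] at h
    simpa using h
  | more k ih _ =>
    have h := conj_mem_reflections b ih (s * t)
    rw [mul_inv_rev, inv_eq_of_mul_eq_one_left (mul_self_of_mem_reflections b hs),
      inv_eq_of_mul_eq_one_left (mul_self_of_mem_reflections b ht)] at h
    convert h using 1
    rw [pow_succ, pow_succ']
    simp only [mul_assoc]

/-- The terms of the sequence `s, sts, ststs, …` of reflections. If `m` is the order of `s * t`,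
then the terms number `0, …, m - 1` are `s, sts, ststs, …, tstst, tst, t`. -/
def alternating (s t : reflections b) (k : ℕ) : reflections b :=
  ⟨((s : P.weylGroup) * t) ^ k * s, alternating_mem b s.2 t.2 k⟩

/-- A numbering `φ` of the reflections is a reflection ordering if, for every dihedral reflection
subgroup with canonical generators `s` and `t`, the sequence
`φ s, φ (sts), φ (ststs), …, φ (tst), φ t` is either increasing or decreasing. -/
def IsReflectionOrdering {n : ℕ} (φ : reflections b ≃ Fin n) : Prop :=
  ∀ H : Subgroup P.weylGroup, IsReflectionSubgroup b H → ∀ s t : reflections b, s ≠ t →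
    canonicalGenerators b H = {(s : P.weylGroup), (t : P.weylGroup)} →
    StrictMonoOn (fun k ↦ φ (alternating b s t k))
        (Set.Iio (orderOf ((s : P.weylGroup) * (t : P.weylGroup)))) ∨
      StrictAntiOn (fun k ↦ φ (alternating b s t k))
        (Set.Iio (orderOf ((s : P.weylGroup) * (t : P.weylGroup))))

/-- The condition under which the reflection `τ` contributes an edge from `u` to `τ * u`: either
`ℓ(τu) = ℓ(u) + 1`, or `ℓ(τu) = ℓ(u) - ℓ(τ)` and `ℓ(τ) = 2 ht(α) - 1`, where `α` is the positive
root whose reflection is `τ`. -/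
def IsStep (τ : reflections b) (u : P.weylGroup) : Prop :=
  len b (τ * u) = len b u + 1 ∨
    ((len b (τ * u) : ℤ) = (len b u : ℤ) - (len b (τ : P.weylGroup) : ℤ) ∧
      ∃ i, b.IsPos i ∧ RootPairing.weylGroup.ofIdx P i = τ ∧
        (len b (τ : P.weylGroup) : ℤ) = 2 * b.height i - 1)

/-- `(u, v)` is an edge of the digraph `D(W)` with `v = τ * u`. -/
def IsEdge (τ : reflections b) (u v : P.weylGroup) : Prop :=
  v = τ * u ∧ IsStep b τ u

/-- `IsPath b u l v`: starting at `u` and following successively the edges of `D(W)` given by the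
reflections in `l`, one arrives at `v`. As the edge from `x` to `y` is given by the reflection
`y * x⁻¹`, the paths from `u` to `v` in `D(W)` correspond one-to-one to such lists `l`. -/
inductive IsPath : P.weylGroup → List (reflections b) → P.weylGroup → Prop
  | nil (u : P.weylGroup) : IsPath u [] u
  | cons {u x v : P.weylGroup} {τ : reflections b} {l : List (reflections b)}
      (h : IsEdge b τ u x) (hl : IsPath x l v) : IsPath u (τ :: l) v

/-- The length of a shortest path from `u` to `v` in `D(W)`. -/
def pathDist (u v : P.weylGroup) : ℕ :=
  sInf {n | ∃ l, IsPath b u l v ∧ l.length = n}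

open Classical in
/-- The operator `Q_τ` on the free `𝕜[ε]`-module with basis `W`: it sends `w` to `τ * w`
if this is an edge, and to `0` otherwise. -/
def opQ (𝕜 : Type*) [Field 𝕜] (τ : reflections b) :
    Module.End (Polynomial 𝕜) (P.weylGroup →₀ Polynomial 𝕜) :=
  Finsupp.linearCombination (Polynomial 𝕜) fun w : P.weylGroup ↦
    if IsStep b τ w then Finsupp.single ((τ : P.weylGroup) * w) (1 : Polynomial 𝕜) else 0

/-- The operator `R_τ = 1 + ε Q_τ`. -/
def opR (𝕜 : Type*) [Field 𝕜] (τ : reflections b) :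
    Module.End (Polynomial 𝕜) (P.weylGroup →₀ Polynomial 𝕜) :=
  1 + (Polynomial.X : Polynomial 𝕜) • opQ b 𝕜 τ

end QuantumBruhat

end

/-! Give the step from `u` to `τu` the defect `ℓ(τu) - ℓ(u) - 1`, increased by `2 ht(α_τ)` if the
step descends. Since `ℓ(τ) ≤ 2 ht(α_τ) - 1`, defects are nonnegative, and the edges of `D(W)` are
exactly the steps of defect zero (`isStep_iff_defect`). Defects telescope along a walk, so inside a
rank two subsystem the total defect depends only on a few numbers attached to the walk. A finite
check (`WalkState.perm_filter_optimal`) matches the increasing walks that can have total defect zero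
with the decreasing ones. This is the Yang–Baxter equation for the `R_τ`
(`IsRankTwoSystem.pathSum_reverse`).

A reflection ordering lists the inversions along a reduced word of the longest element
(`IsMonotoneOnSystems.exists_isInversionSeq`), and by Yang–Baxter the product of the `R_τ` is the
same for all reduced words (`IsYangBaxter.prod_eq`). The product can therefore be made to begin or
to end with `R_s` for any simple `s`. At `ε = 1` the operator `R_s` is `1 + s`, so the matrix of the
product is unchanged when `s` multiplies either of its indices, and all its entries are equal. They
count label-decreasing paths; there is at least one from `1` to `1` and at most one from `1` to the
longest element, so each entry is `1` (`IsMonotoneOnSystems.pathCount_eq_one`). Reversing the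
ordering settles increasing paths.

A lexicographically least shortest path must be increasing: two consecutive labels that do not
increase either cancel or can be exchanged, within rank two, for a pair with smaller first label
(`IsMonotoneOnSystems.exists_exchange`). By uniqueness it is the increasing path. In the product
formula each coefficient thus comes from a single path, of length `ℓ(u,v)`. -/

set_option linter.unusedSectionVars false

/-! ### Weyl group action on roots, heights, lengths, and the defect of a step. -/

noncomputable section

namespace QuantumBruhat

open RootPairing

variable {ι M N : Type*} [AddCommGroup M] [Module ℝ M] [AddCommGroup N] [Module ℝ N]
  {P : RootPairing ι ℝ M N} (b : P.Base)

/-- The reflection in the root with index `i`, as an element of the Weyl group. -/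
abbrev refl (P : RootPairing ι ℝ M N) (i : ι) : P.weylGroup := weylGroup.ofIdx P i

lemma root_smul_idx (w : P.weylGroup) (i : ι) : P.root (w • i) = w • P.root i :=
  Hom.root_weightMap_apply _ _ _ _ |>.symm

lemma refl_smul_idx (i j : ι) : refl P i • j = P.reflectionPerm i j := rfl

lemma root_refl_smul (i j : ι) :
    P.root (refl P i • j) = P.root j - P.pairing j i • P.root i := by
  rw [refl_smul_idx, root_reflectionPerm, reflection_apply_root]

lemma refl_smul_self_root (i : ι) : P.root (refl P i • i) = - P.root i := by
  rw [root_refl_smul, pairing_same]; module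

lemma smul_refl_smul_self (w : P.weylGroup) (i : ι) :
    w • refl P i • i = refl P (w • i) • (w • i) := by
  apply P.root.injective
  rw [root_smul_idx, refl_smul_self_root, refl_smul_self_root, smul_neg, root_smul_idx]

lemma smul_idx_add {w : P.weylGroup} {i j k : ι} (h : P.root k = P.root i + P.root j) :
    P.root (w • k) = P.root (w • i) + P.root (w • j) := by
  simp only [root_smul_idx, h, smul_add]

lemma refl_mul_self (i : ι) : refl P i * refl P i = 1 := by
  apply Subtype.ext
  change Equiv.reflection P i * Equiv.reflection P i = 1
  rw [mul_eq_one_iff_inv_eq, Equiv.reflection_inv P i]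

lemma refl_inv (i : ι) : (refl P i)⁻¹ = refl P i :=
  inv_eq_of_mul_eq_one_left (refl_mul_self i)

lemma refl_mul_cancel_left (i : ι) (w : P.weylGroup) : refl P i * (refl P i * w) = w := by
  rw [← mul_assoc, refl_mul_self, one_mul]

lemma refl_smul_smul (i j : ι) : refl P i • refl P i • j = j := by
  rw [← mul_smul, refl_mul_self, one_smul]

/-- The Weyl group of a root system acts faithfully on the roots. -/
lemma eq_of_smul_idx_eq [P.IsRootSystem] {g h : P.weylGroup} (hgh : ∀ i : ι, g • i = h • i) :
    g = h := by
  refine Subtype.ext <| RootPairing.Equiv.weightHom_injective P <|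
    LinearEquiv.toLinearMap_injective ?_
  refine LinearMap.ext_on (RootPairing.IsRootSystem.span_root_eq_top (P := P)) ?_
  rintro _ ⟨i, rfl⟩
  have h1 := root_smul_idx g i
  rw [hgh i, root_smul_idx] at h1
  exact h1.symm

lemma refl_refl_smul [P.IsRootSystem] (i j : ι) :
    refl P (refl P j • i) = refl P j * refl P i * refl P j := by
  refine eq_of_smul_idx_eq fun k ↦ P.root.injective ?_
  have := LinearEquiv.congr_fun (P.reflection_reflectionPerm (i := i) (j := j)) (P.root k)
  rw [refl_smul_idx, root_reflectionPerm]
  simpa [root_smul_idx, mul_smul, refl_smul_idx, root_reflectionPerm] using this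

lemma refl_smul_eq_conj [P.IsRootSystem] (w : P.weylGroup) (i : ι) :
    refl P (w • i) = w * refl P i * w⁻¹ := by
  obtain ⟨w, hw⟩ := w
  induction hw using weylGroup.induction generalizing i with
  | mem j =>
    change refl P (refl P j • i) = refl P j * refl P i * (refl P j)⁻¹
    rw [refl_refl_smul, refl_inv]
  | one =>
    change refl P ((1 : P.weylGroup) • i) = 1 * refl P i * (1 : P.weylGroup)⁻¹
    simp
  | mul x y hx hy ihx ihy =>
    have h : (⟨x * y, mul_mem hx hy⟩ : P.weylGroup) = ⟨x, hx⟩ * ⟨y, hy⟩ := rfl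
    rw [h, mul_smul, ihx, ihy]
    group

lemma refl_opp [P.IsRootSystem] (i : ι) : refl P (refl P i • i) = refl P i := by
  rw [refl_refl_smul, refl_mul_self, one_mul]

lemma refl_eq_refl_iff [Finite ι] [P.IsRootSystem] [P.IsReduced] {i j : ι} :
    refl P i = refl P j ↔ i = j ∨ i = refl P j • j := by
  constructor
  · intro h
    by_contra! hc
    have hlin : LinearIndependent ℝ ![P.root i, P.root j] := by
      refine IsReduced.linearIndependent P hc.1 fun h' ↦ hc.2 (P.root.injective ?_)
      rw [h', refl_smul_self_root]
    have h1 := root_refl_smul (P := P) i i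
    rw [h, root_refl_smul, pairing_same] at h1
    rw [LinearIndependent.pair_iff] at hlin
    have := (hlin 2 (-P.pairing i j) (by
      rw [neg_smul, ← sub_eq_add_neg, sub_eq_zero]
      have h2 : P.root i - P.pairing i j • P.root j + (2 : ℝ) • P.root i = P.root i := by
        rw [h1]; module
      calc (2 : ℝ) • P.root i = P.root i - (P.root i - P.pairing i j • P.root j) := by
            rw [h1]; module
        _ = _ := by module)).1
    norm_num at this
  · rintro (rfl | rfl)
    · rfl
    · exact refl_opp j

section Height

lemma height_eq_of_root_eq {i j k : ι} {x y : ℤ}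
    (hk : P.root k = x • P.root i + y • P.root j) :
    b.height k = x * b.height i + y * b.height j := by
  obtain ⟨f, -, -, hf⟩ := b.exists_root_eq_sum_int i
  obtain ⟨g, -, -, hg⟩ := b.exists_root_eq_sum_int j
  have hfg : P.root k = ∑ l ∈ b.support, (x • f + y • g) l • P.root l := by
    simp_rw [Pi.add_apply, Pi.smul_apply, add_smul, smul_assoc, Finset.sum_add_distrib,
      ← Finset.smul_sum, ← hf, ← hg, hk]
  rw [Base.height_eq_sum hf, Base.height_eq_sum hg, Base.height_eq_sum hfg]
  simp [Finset.sum_add_distrib, Finset.mul_sum]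

lemma height_opp (i : ι) : b.height (refl P i • i) = - b.height i :=
  b.height_reflectionPerm_self i

lemma isPos_opp (i : ι) : b.IsPos (refl P i • i) ↔ ¬ b.IsPos i := by
  have := b.height_ne_zero i
  rw [Base.isPos_iff, Base.isPos_iff, height_opp]
  lia

lemma isPos_opp_smul (w : P.weylGroup) (i : ι) :
    b.IsPos (w • refl P i • i) ↔ ¬ b.IsPos (w • i) := by
  rw [smul_refl_smul_self, isPos_opp]

lemma isPos_mul_refl (w : P.weylGroup) (i : ι) :
    b.IsPos ((refl P i * w)⁻¹ • i) ↔ ¬ b.IsPos (w⁻¹ • i) := by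
  rw [mul_inv_rev, refl_inv, mul_smul, isPos_opp_smul]

end Height

section Length

lemma refl_mem_simpleReflections {i : ι} (hi : i ∈ b.support) :
    refl P i ∈ simpleReflections b := ⟨i, hi, rfl⟩

lemma len_le_of_prod {l : List P.weylGroup} (hl : ∀ s ∈ l, s ∈ simpleReflections b) :
    len b l.prod ≤ l.length :=
  Nat.sInf_le ⟨l, hl, rfl, rfl⟩

variable [Finite ι] [P.IsRootSystem] [P.IsCrystallographic] [P.IsReduced]

lemma exists_word_refl (i : ι) :
    ∃ l : List P.weylGroup, (∀ s ∈ l, s ∈ simpleReflections b) ∧ l.prod = refl P i := by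
  induction i using b.induction_reflect with
  | h₀ i hi =>
    rw [← refl_smul_idx, refl_opp]
    exact hi
  | h₁ i hi => exact ⟨[refl P i], by simpa using refl_mem_simpleReflections b hi, by simp⟩
  | h₂ i j hi hj =>
    obtain ⟨l, hl, h⟩ := hi
    refine ⟨refl P j :: (l ++ [refl P j]), ?_, ?_⟩
    · have := refl_mem_simpleReflections b hj
      simp only [List.mem_cons, List.mem_append]
      rintro s (rfl | hs | hs | hs)
      · exact this
      · exact hl s hs
      · exact hs ▸ this
      · simp at hs
    · rw [← refl_smul_idx, refl_refl_smul, ← h]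
      simp [mul_assoc]

lemma exists_word (w : P.weylGroup) :
    ∃ l : List P.weylGroup, (∀ s ∈ l, s ∈ simpleReflections b) ∧ l.prod = w := by
  obtain ⟨w, hw⟩ := w
  induction hw using weylGroup.induction with
  | mem i => exact exists_word_refl b i
  | one => exact ⟨[], by simp, rfl⟩
  | mul x y hx hy ihx ihy =>
    obtain ⟨l, hl, h⟩ := ihx
    obtain ⟨l', hl', h'⟩ := ihy
    refine ⟨l ++ l', ?_, ?_⟩
    · simp only [List.mem_append]
      rintro s (hs | hs)
      exacts [hl s hs, hl' s hs]
    · rw [List.prod_append, h, h']; rfl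

lemma exists_reduced_word (w : P.weylGroup) :
    ∃ l : List P.weylGroup, (∀ s ∈ l, s ∈ simpleReflections b) ∧ l.prod = w ∧
      l.length = len b w := by
  obtain ⟨l, hl, h⟩ := exists_word b w
  exact Nat.sInf_mem (s := {n | ∃ l : List P.weylGroup,
    (∀ s ∈ l, s ∈ simpleReflections b) ∧ l.prod = w ∧ l.length = n}) ⟨_, l, hl, h, rfl⟩

lemma len_one : len b (1 : P.weylGroup) = 0 :=
  Nat.le_zero.mp (len_le_of_prod b (l := []) (by simp))

lemma len_mul_le (v w : P.weylGroup) : len b (v * w) ≤ len b v + len b w := by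
  obtain ⟨l, hl, rfl, h⟩ := exists_reduced_word b v
  obtain ⟨l', hl', rfl, h'⟩ := exists_reduced_word b w
  rw [← List.prod_append, ← h, ← h', ← List.length_append]
  refine len_le_of_prod b fun s hs ↦ ?_
  rcases List.mem_append.mp hs with hs | hs
  exacts [hl s hs, hl' s hs]

lemma len_refl_of_mem {i : ι} (hi : i ∈ b.support) : len b (refl P i) ≤ 1 := by
  simpa using len_le_of_prod b (l := [refl P i])
    (by simpa using refl_mem_simpleReflections b hi)

/-- The exchange property. -/
lemma exists_shorter_word {l : List P.weylGroup} (hl : ∀ s ∈ l, s ∈ simpleReflections b)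
    {i : ι} (hi : b.IsPos i) (h : ¬ b.IsPos (l.prod⁻¹ • i)) :
    ∃ l' : List P.weylGroup, (∀ s ∈ l', s ∈ simpleReflections b) ∧
      l'.prod = refl P i * l.prod ∧ l'.length + 1 = l.length := by
  induction l generalizing i with
  | nil => simp [hi] at h
  | cons s t ih =>
    obtain ⟨j, hj, rfl⟩ := hl s (by simp)
    have ht : ∀ s ∈ t, s ∈ simpleReflections b := fun s hs ↦ hl s (by simp [hs])
    rcases eq_or_ne i j with rfl | hij
    · refine ⟨t, ht, ?_, by simp⟩
      rw [List.prod_cons, refl_mul_cancel_left]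
    · have hpos : b.IsPos (refl P j • i) := hi.reflectionPerm hj hij
      obtain ⟨l', hl', hprod, hlen⟩ := ih ht hpos (by
        rwa [List.prod_cons, mul_inv_rev, mul_smul, refl_inv] at h)
      refine ⟨refl P j :: l', ?_, ?_, by simpa using hlen⟩
      · simp only [List.mem_cons]
        rintro s (rfl | hs)
        exacts [refl_mem_simpleReflections b hj, hl' s hs]
      · rw [List.prod_cons, hprod, refl_refl_smul, List.prod_cons]
        simp only [mul_assoc, refl_mul_cancel_left]

/-- The exchange property deletes a letter from a reduced word of `u`. Together with
`lt_len_refl_mul` it says that the sign of `u⁻¹ • i` decides whether the step ascends or descends.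
-/
lemma len_refl_mul_lt {u : P.weylGroup} {i : ι} (hi : b.IsPos i) (h : ¬ b.IsPos (u⁻¹ • i)) :
    len b (refl P i * u) < len b u := by
  obtain ⟨l, hl, rfl, hlen⟩ := exists_reduced_word b u
  obtain ⟨l', hl', hprod, hlen'⟩ := exists_shorter_word b hl hi h
  rw [← hprod, ← hlen, ← hlen']
  exact Nat.lt_succ_of_le (len_le_of_prod b hl')

lemma lt_len_refl_mul {u : P.weylGroup} {i : ι} (hi : b.IsPos i) (h : b.IsPos (u⁻¹ • i)) :
    len b u < len b (refl P i * u) := by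
  have := len_refl_mul_lt b (u := refl P i * u) hi (by rwa [isPos_mul_refl, not_not])
  rwa [refl_mul_cancel_left] at this

lemma mul_refl_eq (u : P.weylGroup) (i : ι) : u * refl P i = refl P (u • i) * u := by
  rw [refl_smul_eq_conj]; group

lemma len_mul_refl_of_isPos {u : P.weylGroup} {i : ι} (hi : i ∈ b.support)
    (h : b.IsPos (u • i)) : len b (u * refl P i) = len b u + 1 := by
  refine le_antisymm ((len_mul_le b _ _).trans (by simpa using len_refl_of_mem b hi)) ?_
  rw [mul_refl_eq]
  exact lt_len_refl_mul b h (by simpa using Base.isPos_of_mem_support hi)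

lemma len_mul_refl_of_not_isPos {u : P.weylGroup} {i : ι} (hi : i ∈ b.support)
    (h : ¬ b.IsPos (u • i)) : len b (u * refl P i) + 1 = len b u := by
  have := len_mul_refl_of_isPos b (u := u * refl P i) hi (by
    rw [mul_smul, isPos_opp_smul]; exact h)
  rw [mul_assoc, refl_mul_self, mul_one] at this
  exact this.symm

lemma len_refl_simple_mul_of_isPos {u : P.weylGroup} {i : ι} (hi : i ∈ b.support)
    (h : b.IsPos (u⁻¹ • i)) : len b (refl P i * u) = len b u + 1 := by
  have h1 := len_mul_le b (refl P i) u
  have h2 := len_refl_of_mem b hi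
  have h3 := lt_len_refl_mul b (Base.isPos_of_mem_support hi) h
  lia

lemma len_refl_simple_mul_of_not_isPos {u : P.weylGroup} {i : ι} (hi : i ∈ b.support)
    (h : ¬ b.IsPos (u⁻¹ • i)) : len b (refl P i * u) + 1 = len b u := by
  have := len_refl_simple_mul_of_isPos b (u := refl P i * u) hi (by rwa [isPos_mul_refl])
  rw [refl_mul_cancel_left] at this
  exact this.symm

/-- Induction on the height: a non-simple positive root pairs positively with some simple root,
whose reflection lowers the height by at least one, while conjugation by it changes the length by at
most two. -/
lemma len_refl_le {i : ι} (hi : b.IsPos i) :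
    (len b (refl P i) : ℤ) ≤ 2 * b.height i - 1 := by
  generalize hN : (b.height i).toNat = n
  induction n using Nat.strong_induction_on generalizing i with
  | _ n ih =>
    have hpos := (b.isPos_iff).mp hi
    obtain ⟨j, hj, hj'⟩ := hi.exists_mem_support_pos_pairingIn
    rw [P.zero_lt_pairingIn_iff'] at hj'
    rcases eq_or_ne i j with rfl | hij
    · have := len_refl_of_mem b hj
      lia
    · have hk : b.IsPos (refl P j • i) := hi.reflectionPerm hj hij
      have hroot : P.root (refl P j • i) =
          (1 : ℤ) • P.root i + (-P.pairingIn ℤ i j) • P.root j := by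
        rw [refl_smul_idx, root_reflectionPerm, reflection_apply_root' ℤ]; module
      have hh := height_eq_of_root_eq b hroot
      rw [Base.height_one_of_mem_support hj] at hh
      have hkp := (b.isPos_iff).mp hk
      have h1 := ih _ (by lia) hk rfl
      have h2 : refl P i = refl P j * refl P (refl P j • i) * refl P j := by
        rw [← refl_refl_smul, refl_smul_smul]
      have h3 := len_mul_le b (refl P j * refl P (refl P j • i)) (refl P j)
      have h4 := len_mul_le b (refl P j) (refl P (refl P j • i))
      have h5 := len_refl_of_mem b hj
      rw [← h2] at h3
      lia

end Length

section Energy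

variable [Finite ι] [P.IsRootSystem] [P.IsCrystallographic] [P.IsReduced]

lemma refl_mem_reflections (i : ι) : refl P i ∈ reflections b := by
  induction i using b.induction_reflect with
  | h₀ i hi => rwa [← refl_smul_idx, refl_opp]
  | h₁ i hi => exact ⟨1, refl P i, refl_mem_simpleReflections b hi, by group⟩
  | h₂ i j hi hj =>
    rw [← refl_smul_idx, refl_smul_eq_conj]
    exact conj_mem_reflections b hi _

/-- The reflection in the root with index `i`, as an element of the set of reflections. -/
def toRefl (i : ι) : reflections b := ⟨refl P i, refl_mem_reflections b i⟩

@[simp] lemma coe_toRefl (i : ι) : (toRefl b i : P.weylGroup) = refl P i := rfl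

lemma toRefl_eq_iff {i j : ι} : toRefl b i = toRefl b j ↔ i = j ∨ i = refl P j • j := by
  rw [Subtype.ext_iff]
  exact refl_eq_refl_iff

lemma toRefl_inj {i j : ι} (hi : b.IsPos i) (hj : b.IsPos j) :
    toRefl b i = toRefl b j ↔ i = j := by
  rw [toRefl_eq_iff, or_iff_left]
  rintro rfl
  exact (isPos_opp b j).mp hi hj

lemma exists_toRefl (τ : reflections b) : ∃ i, b.IsPos i ∧ toRefl b i = τ := by
  obtain ⟨_, w, _, ⟨i, hi, rfl⟩, rfl⟩ := τ
  by_cases h : b.IsPos (w • i)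
  · exact ⟨w • i, h, Subtype.ext (refl_smul_eq_conj w i)⟩
  · refine ⟨refl P (w • i) • w • i, by rwa [isPos_opp], Subtype.ext ?_⟩
    rw [coe_toRefl, refl_opp]
    exact refl_smul_eq_conj w i

open Classical in
/-- The defect of the step from `u` to `refl P i * u`: it is nonnegative, and it vanishes exactly
for the edges of the quantum Bruhat graph. -/
def defect (i : ι) (u : P.weylGroup) : ℤ :=
  len b (refl P i * u) - len b u - 1 + if b.IsPos (u⁻¹ • i) then 0 else 2 * b.height i

lemma len_sub_le (i : ι) (u : P.weylGroup) :
    (len b u : ℤ) - len b (refl P i * u) ≤ len b (refl P i) := by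
  have := len_mul_le b (refl P i) (refl P i * u)
  rw [refl_mul_cancel_left] at this
  lia

lemma defect_nonneg {i : ι} (hi : b.IsPos i) (u : P.weylGroup) : 0 ≤ defect b i u := by
  unfold defect
  split_ifs with h
  · have := lt_len_refl_mul b hi h
    lia
  · have := len_sub_le b i u
    have := len_refl_le b hi
    lia

/-- For a descending step the defect is the sum of the nonnegative integers `ℓ(τu) - ℓ(u) + ℓ(τ)`
and `2 ht - 1 - ℓ(τ)`; both vanish exactly for a quantum edge. -/
lemma isStep_iff_defect {i : ι} (hi : b.IsPos i) (u : P.weylGroup) :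
    IsStep b (toRefl b i) u ↔ defect b i u = 0 := by
  have h1 := len_sub_le b i u
  have h2 := len_refl_le b hi
  have h3 := (b.isPos_iff).mp hi
  unfold IsStep defect
  rw [coe_toRefl]
  split_ifs with h
  · have := lt_len_refl_mul b hi h
    constructor
    · rintro (h | ⟨h, -⟩) <;> lia
    · intro h
      left; lia
  · have := len_refl_mul_lt b hi h
    constructor
    · rintro (h | ⟨h, j, hj, hij, hlen⟩)
      · lia
      · have : j = i := (toRefl_inj b hj hi).mp (Subtype.ext hij)
        subst this
        lia
    · intro h
      exact Or.inr ⟨by lia, i, hi, rfl, by lia⟩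

lemma isStep_simple {i : ι} (hi : i ∈ b.support) (u : P.weylGroup) :
    IsStep b (toRefl b i) u := by
  rw [isStep_iff_defect b (Base.isPos_of_mem_support hi)]
  unfold defect
  split_ifs with h
  · have := len_refl_simple_mul_of_isPos b hi h
    lia
  · have := len_refl_simple_mul_of_not_isPos b hi h
    rw [Base.height_one_of_mem_support hi]
    lia

end Energy

end QuantumBruhat

end

/-! ### Finite combinatorics of the four rank two types. -/

noncomputable section

namespace QuantumBruhat

/-- The types of finite crystallographic root systems of rank two. -/
inductive RankTwoType
  | A₁A₁ | A₂ | B₂ | G₂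

namespace RankTwoType

/-- The coordinates of the positive roots, listed by increasing angle, with respect to the base
formed by the first and the last one. -/
def coords : RankTwoType → List (ℕ × ℕ)
  | A₁A₁ => [(1, 0), (0, 1)]
  | A₂ => [(1, 0), (1, 1), (0, 1)]
  | B₂ => [(1, 0), (2, 1), (1, 1), (0, 1)]
  | G₂ => [(1, 0), (3, 1), (2, 1), (3, 2), (1, 1), (0, 1)]

/-- The number of positive roots. -/
def order (k : RankTwoType) : ℕ := k.coords.length

/-- The first coordinate of the `j`-th positive root. -/
def fstCoord (k : RankTwoType) (j : ℕ) : ℕ := (k.coords.getD j (0, 0)).1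

/-- The second coordinate of the `j`-th positive root. -/
def sndCoord (k : RankTwoType) (j : ℕ) : ℕ := (k.coords.getD j (0, 0)).2

lemma two_le_order (k : RankTwoType) : 2 ≤ k.order := by
  cases k <;> decide

lemma coord_pos (k : RankTwoType) :
    ∀ j < k.order, 0 < k.fstCoord j + k.sndCoord j := by
  cases k <;> decide

/-- The positive roots are listed by increasing angle. -/
lemma det_pos (k : RankTwoType) : ∀ j < k.order, ∀ i < j,
    k.fstCoord j * k.sndCoord i < k.fstCoord i * k.sndCoord j := by
  cases k <;> decide

/-- With `not_add_of_last` this singles out the first and the last root as the indecomposable ones,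
hence as the canonical generators. -/
lemma exists_add (k : RankTwoType) : ∀ j < k.order, j ≠ 0 → j ≠ k.order - 1 →
    ∃ i < k.order, ∃ l < k.order, k.fstCoord j = k.fstCoord i + k.fstCoord l ∧
      k.sndCoord j = k.sndCoord i + k.sndCoord l := by
  cases k <;> decide

set_option synthInstance.maxSize 1000 in
set_option synthInstance.maxHeartbeats 200000 in
lemma between_of_add (k : RankTwoType) : ∀ i < k.order, ∀ j < k.order, ∀ l < k.order,
    k.fstCoord j = k.fstCoord i + k.fstCoord l ∧ k.sndCoord j = k.sndCoord i + k.sndCoord l →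
    i < j ∧ j < l ∨ l < j ∧ j < i := by
  cases k <;> decide

lemma not_add_of_last (k : RankTwoType) : ∀ i < k.order, ∀ l < k.order,
    ¬ (k.fstCoord 0 = k.fstCoord i + k.fstCoord l ∧ k.sndCoord 0 = k.sndCoord i + k.sndCoord l) ∧
    ¬ (k.fstCoord (k.order - 1) = k.fstCoord i + k.fstCoord l ∧
      k.sndCoord (k.order - 1) = k.sndCoord i + k.sndCoord l) := by
  cases k <;> decide

end RankTwoType

/-- The state of a walk in the Weyl group of a rank two system: the index `pos` of the first root
sent to a positive one, the rotation part `rot` of the product of the reflections used so far, their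
number `len`, and the sum of the coordinates of the roots of the descending steps. -/
structure WalkState where
  pos : ℕ
  rot : ℕ
  len : ℕ
  fst : ℕ
  snd : ℕ
  deriving DecidableEq

namespace WalkState

/-- The state after the `i`-th reflection. -/
def step (k : RankTwoType) (s : WalkState) (i : ℕ) : WalkState where
  -- The reflection acts on indices by `j ↦ 2i - j + k.order`, which carries the window of `k.order`
  -- indices from `s.pos` on to the one from `2i + 1 - s.pos` on; the extra `2 * k.order` prevents
  -- truncation.
  pos := (2 * i + 1 + 2 * k.order - s.pos) % (2 * k.order)
  -- With `r` the product of the first and the last reflection, the `i`-th reflection is `r ^ i *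
  -- s₀`, and `s₀` inverts `r`.
  rot := (i + k.order - s.rot) % k.order
  len := s.len + 1
  -- The test asks whether `i` lies in the current window, that is, whether the step ascends; only
  -- descending steps contribute their root.
  fst := if (i + 2 * k.order - s.pos) % (2 * k.order) < k.order then s.fst
    else s.fst + k.fstCoord i
  snd := if (i + 2 * k.order - s.pos) % (2 * k.order) < k.order then s.snd
    else s.snd + k.sndCoord i

/-- The initial state. -/
def init (p : ℕ) : WalkState := ⟨p, 0, 0, 0, 0⟩

/-- The state after a sequence of reflections. -/
def run (k : RankTwoType) (p : ℕ) (l : List ℕ) : WalkState := l.foldl (step k) (init p)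

/-- Any walk with state `t` is more efficient than any walk with state `s`. -/
def dominates (t s : WalkState) : Bool :=
  t.rot == s.rot && t.len % 2 == s.len % 2 && t.fst ≤ s.fst && t.snd ≤ s.snd &&
    -- The heights of the two simple roots are unknown positive integers; as the coordinates of `t`
    -- do not exceed those of `s`, the least favourable case is that both heights are one, which is
    -- this inequality.
    s.len + 2 * (t.fst + t.snd) < t.len + 2 * (s.fst + s.snd)

/-- The final states of the walks with increasing indices. -/
def increasing (k : RankTwoType) (p : ℕ) : List WalkState :=
  (List.range k.order).sublists.map (run k p)

/-- The final states of the walks with decreasing indices. -/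
def decreasing (k : RankTwoType) (p : ℕ) : List WalkState :=
  (List.range k.order).reverse.sublists.map (run k p)

/-- The states that are not dominated by the final state of a monotone walk. -/
def optimal (k : RankTwoType) (p : ℕ) (s : WalkState) : Bool :=
  !(increasing k p).any (dominates · s) && !(decreasing k p).any (dominates · s)

/-- The computational core of the Yang–Baxter equation. Discarded states never belong to paths
(`optimal_of_defectSum_eq_zero`), and whether a remaining state does is decided by the state alone,
so matching states suffices. -/
lemma perm_filter_optimal (k : RankTwoType) : ∀ p < 2 * k.order,
    ((increasing k p).filter (optimal k p)).Perm ((decreasing k p).filter (optimal k p)) := by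
  cases k <;> decide +kernel

end WalkState

end QuantumBruhat

end

/-! ### Paths and the expansion of products of the operators `R_τ`. -/

noncomputable section

namespace QuantumBruhat

open RootPairing Polynomial

variable {ι M N : Type*} [AddCommGroup M] [Module ℝ M] [AddCommGroup N] [Module ℝ N]
  {P : RootPairing ι ℝ M N} (b : P.Base)

section Paths

/-- The element reached from `u` by following the reflections in `l`. -/
def walk (u : P.weylGroup) (l : List (reflections b)) : P.weylGroup :=
  l.foldl (fun x τ ↦ (τ : P.weylGroup) * x) u

@[simp] lemma walk_nil (u : P.weylGroup) : walk b u [] = u := rfl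

@[simp] lemma walk_cons (u : P.weylGroup) (τ : reflections b) (l : List (reflections b)) :
    walk b u (τ :: l) = walk b (τ * u) l := rfl

lemma walk_append (u : P.weylGroup) (l l' : List (reflections b)) :
    walk b u (l ++ l') = walk b (walk b u l) l' := by
  simp [walk, List.foldl_append]

lemma isPath_nil_iff {u v : P.weylGroup} : IsPath b u [] v ↔ v = u := by
  constructor
  · rintro ⟨⟩; rfl
  · rintro rfl; exact .nil _

lemma isPath_cons_iff {u v : P.weylGroup} {τ : reflections b} {l : List (reflections b)} :
    IsPath b u (τ :: l) v ↔ IsStep b τ u ∧ IsPath b (τ * u) l v := by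
  constructor
  · rintro (_ | @⟨_, x, _, _, _, ⟨rfl, h⟩, hl⟩)
    exact ⟨h, hl⟩
  · rintro ⟨h, hl⟩
    exact .cons ⟨rfl, h⟩ hl

lemma isPath_append_iff {u v : P.weylGroup} {l l' : List (reflections b)} :
    IsPath b u (l ++ l') v ↔ IsPath b u l (walk b u l) ∧ IsPath b (walk b u l) l' v := by
  induction l generalizing u with
  | nil => simp [isPath_nil_iff]
  | cons τ l ih => simp [isPath_cons_iff, ih, and_assoc]

lemma IsPath.eq_walk {u v : P.weylGroup} {l : List (reflections b)} (h : IsPath b u l v) :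
    v = walk b u l := by
  induction l generalizing u with
  | nil => exact (isPath_nil_iff b).mp h
  | cons τ l ih => exact ih ((isPath_cons_iff b).mp h).2

lemma isPath_singleton_iff {u v : P.weylGroup} {τ : reflections b} :
    IsPath b u [τ] v ↔ IsStep b τ u ∧ v = τ * u := by
  rw [isPath_cons_iff, isPath_nil_iff]

end Paths

section Operators

variable (𝕜 : Type*) [Field 𝕜]

open Classical in
/-- The contribution of the sequence `l` of reflections to the expansion of a product of the
operators `R_τ` applied to `u`. -/
def pathTerm (u : P.weylGroup) (l : List (reflections b)) : P.weylGroup →₀ 𝕜[X] :=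
  if IsPath b u l (walk b u l) then Finsupp.single (walk b u l) (X ^ l.length) else 0

/-- The sum of the contributions of the sublists of `l`. -/
def pathSum (u : P.weylGroup) (l : List (reflections b)) : P.weylGroup →₀ 𝕜[X] :=
  (l.sublists.map (pathTerm b 𝕜 u)).sum

lemma opR_single (τ : reflections b) (w : P.weylGroup) (a : 𝕜[X]) [Decidable (IsStep b τ w)] :
    opR b 𝕜 τ (Finsupp.single w a) =
      Finsupp.single w a + if IsStep b τ w then Finsupp.single (τ * w) (a * X) else 0 := by
  simp only [opR, opQ, LinearMap.add_apply, Module.End.one_apply, LinearMap.smul_apply,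
    Finsupp.linearCombination_single]
  congr 1
  split_ifs
  · rw [Finsupp.smul_single, Finsupp.smul_single, smul_eq_mul, smul_eq_mul, mul_one, mul_comm]
  · simp

lemma opR_pathTerm (τ : reflections b) (u : P.weylGroup) (l : List (reflections b)) :
    opR b 𝕜 τ (pathTerm b 𝕜 u l) = pathTerm b 𝕜 u l + pathTerm b 𝕜 u (l ++ [τ]) := by
  classical
  unfold pathTerm
  rw [isPath_append_iff, walk_append, isPath_singleton_iff, List.length_append]
  by_cases h : IsPath b u l (walk b u l)
  · by_cases h' : IsStep b τ (walk b u l) <;> simp [h, h', opR_single, pow_succ]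
  · simp [h]

/-- A sublist of `l ++ [τ]` either omits the final `τ` or uses it, matching the two summands of `1 +
ε Q_τ`. -/
lemma opR_pathSum (τ : reflections b) (u : P.weylGroup) (l : List (reflections b)) :
    opR b 𝕜 τ (pathSum b 𝕜 u l) = pathSum b 𝕜 u (l ++ [τ]) := by
  simp only [pathSum, List.sublists_concat, List.map_append, List.sum_append, List.map_map,
    map_list_sum]
  rw [← List.sum_map_add]
  congr 1
  refine List.map_congr_left fun l' _ ↦ ?_
  exact opR_pathTerm b 𝕜 τ u l'

/-- The expansion of a product of the operators `R_τ`. -/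
lemma prod_opR_single (u : P.weylGroup) (l : List (reflections b)) :
    (l.map (opR b 𝕜)).prod (Finsupp.single u 1) = pathSum b 𝕜 u l.reverse := by
  induction l with
  | nil => simp [pathSum, pathTerm, isPath_nil_iff]
  | cons τ l ih =>
    -- The rightmost factor acts first, so paths follow the list backwards.
    rw [List.map_cons, List.prod_cons, Module.End.mul_apply, ih, opR_pathSum, List.reverse_cons]

end Operators

end QuantumBruhat

end

/-! ### Walks in rank two systems and the Yang–Baxter equation. -/

noncomputable section

namespace QuantumBruhat

open RootPairing Polynomial

lemma _root_.List.sublist_of_pairwise_of_subset {α : Type*} {r : α → α → Prop} [IsStrictOrder α r]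
    {l l' : List α} (hl : l.Pairwise r) (hl' : l'.Pairwise r) (h : l ⊆ l') : l.Sublist l' := by
  have : Std.Antisymm r := ⟨fun a c h1 h2 ↦ absurd (_root_.trans h1 h2) (irrefl a)⟩
  exact List.sublist_of_subperm_of_pairwise
    (List.subperm_of_subset hl.nodup h) hl hl'

lemma RankTwoType.order_eq (k : RankTwoType) :
    k.order = 2 ∨ k.order = 3 ∨ k.order = 4 ∨ k.order = 6 := by
  cases k
  exacts [.inl rfl, .inr (.inl rfl), .inr (.inr (.inl rfl)), .inr (.inr (.inr rfl))]

lemma window_reflect {m : ℕ} (hm : m = 2 ∨ m = 3 ∨ m = 4 ∨ m = 6) {p : ℕ} (hp : p < 2 * m)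
    (i : ℕ) (j : ℤ) :
    (2 * (i : ℤ) - j + m - p) % (2 * m) < m ↔
      (j - ((2 * i + 1 + 2 * m - p) % (2 * m) : ℕ)) % (2 * m) < m := by
  rcases hm with rfl | rfl | rfl | rfl <;> push_cast <;> lia

variable {ι M N : Type*} [AddCommGroup M] [Module ℝ M] [AddCommGroup N] [Module ℝ N]
  {P : RootPairing ι ℝ M N} (b : P.Base)

/-- `γ` lists the roots of a root subsystem of rank two by increasing angle, in such a way that
`γ 0` and `γ (m - 1)` are its simple roots, where `m` is the number of its positive roots. -/
structure IsRankTwoSystem (k : RankTwoType) (γ : ℤ → ι) : Prop where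
  opp (j : ℤ) : γ (j + k.order) = refl P (γ j) • γ j
  -- In units of `π / k.order` the index is an angle; reflecting in the line orthogonal to direction
  -- `i` sends angle `j` to `2i - j` plus a half turn.
  refl_smul (i j : ℤ) : refl P (γ i) • γ j = γ (2 * i - j + k.order)
  root_eq (j : ℕ) (hj : j < k.order) : P.root (γ j) =
    (k.fstCoord j : ℤ) • P.root (γ 0) + (k.sndCoord j : ℤ) • P.root (γ (k.order - 1))
  isPos_zero : b.IsPos (γ 0)
  isPos_last : b.IsPos (γ (k.order - 1))
  ne : γ 0 ≠ γ (k.order - 1)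

namespace IsRankTwoSystem

variable {b} [Finite ι] [P.IsRootSystem] [P.IsCrystallographic] [P.IsReduced]
  {k : RankTwoType} {γ : ℤ → ι} (h : IsRankTwoSystem b k γ)

include h

lemma refl_add_order (j : ℤ) : refl P (γ (j + k.order)) = refl P (γ j) := by
  rw [h.opp, refl_opp]

lemma add_two_mul_order (j : ℤ) : γ (j + 2 * k.order) = γ j := by
  rw [two_mul, ← add_assoc, h.opp, h.refl_add_order, h.opp, refl_smul_smul]

lemma emod (j : ℤ) : γ (j % (2 * k.order)) = γ j := by
  have hper : Function.Periodic γ (2 * k.order) := h.add_two_mul_order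
  have := hper.int_mul (j / (2 * k.order)) (j % (2 * k.order))
  rw [← this]
  congr 1
  have := Int.emod_add_mul_ediv j (2 * k.order)
  push_cast
  linarith

lemma height_smul (w : P.weylGroup) {j : ℕ} (hj : j < k.order) :
    b.height (w • γ j) = k.fstCoord j * b.height (w • γ 0) +
      k.sndCoord j * b.height (w • γ (k.order - 1)) := by
  refine height_eq_of_root_eq b ?_
  rw [root_smul_idx, h.root_eq j hj, smul_add, root_smul_idx, root_smul_idx]
  congr 1 <;> simp only [← Int.cast_smul_eq_zsmul ℝ] <;> exact (smul_comm _ _ _)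

lemma isPos {j : ℕ} (hj : j < k.order) : b.IsPos (γ j) := by
  have h1 := h.height_smul 1 hj
  simp only [one_smul] at h1
  have h2 := b.isPos_iff.mp h.isPos_zero
  have h3 := b.isPos_iff.mp h.isPos_last
  have h4 := k.coord_pos j hj
  rw [b.isPos_iff, h1]
  rcases Nat.eq_zero_or_pos (k.fstCoord j) with h5 | h5
  · have : 0 < k.sndCoord j := by lia
    rw [h5]; positivity
  · positivity

/-- The rotation generating the rotation subgroup of the Weyl group of the subsystem. -/
lemma rot_smul (j : ℤ) :
    (refl P (γ 0) * refl P (γ (k.order - 1))) • γ j = γ (j + 2) := by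
  rw [mul_smul, h.refl_smul, h.refl_smul, ← h.add_two_mul_order]
  congr 1
  ring

lemma refl_eq_pow (j : ℕ) :
    refl P (γ j) = (refl P (γ 0) * refl P (γ (k.order - 1))) ^ j * refl P (γ 0) := by
  induction j using Nat.twoStepInduction with
  | zero => simp
  | one =>
    have h1 : γ 1 = refl P (γ 0) • γ (k.order - 1) := by
      rw [h.refl_smul]; congr 1; ring
    rw [Nat.cast_one, h1, refl_refl_smul, pow_one]
  | more j ih _ =>
    have h1 : γ ((j + 2 : ℕ) : ℤ) = (refl P (γ 0) * refl P (γ (k.order - 1))) • γ j := by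
      rw [h.rot_smul]; congr 1
    rw [h1, refl_smul_eq_conj, ih, mul_inv_rev, refl_inv, refl_inv, pow_succ' _ (j + 1), pow_succ]
    simp only [mul_assoc]

lemma rot_pow_order : (refl P (γ 0) * refl P (γ (k.order - 1))) ^ k.order = 1 := by
  have h1 := h.refl_eq_pow k.order
  have h2 := h.refl_add_order 0
  rw [zero_add] at h2
  rw [h2] at h1
  exact (mul_eq_right.mp h1.symm)

lemma rot_pow_mul_refl_mul_rot_pow (e : ℕ) :
    (refl P (γ 0) * refl P (γ (k.order - 1))) ^ e * refl P (γ 0) *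
      (refl P (γ 0) * refl P (γ (k.order - 1))) ^ e = refl P (γ 0) := by
  have h1 := refl_mul_self (P := P) (γ e)
  rw [h.refl_eq_pow e, ← mul_assoc] at h1
  rw [eq_inv_of_mul_eq_one_left h1, refl_inv]

section Walks

/-- The product of the reflections used in a walk with the given final state. -/
def element (_ : IsRankTwoSystem b k γ) (s : WalkState) : P.weylGroup :=
  (refl P (γ 0) * refl P (γ (k.order - 1))) ^ s.rot *
    if s.len % 2 = 0 then 1 else refl P (γ 0)

/-- The sum of the defects of the steps of a walk from `u` with the given final state. -/
def defectSum (u : P.weylGroup) (s : WalkState) : ℤ :=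
  len b (h.element s * u) - len b u - s.len +
    2 * (s.fst * b.height (γ 0) + s.snd * b.height (γ (k.order - 1)))

/-- The roots in the system with indices from `p` to `p + m - 1` are those that are sent to
positive roots by the inverse of `x`. -/
def Window (_ : IsRankTwoSystem b k γ) (x : P.weylGroup) (p : ℕ) : Prop :=
  ∀ j : ℤ, b.IsPos (x⁻¹ • γ j) ↔ (j - p) % (2 * k.order) < k.order

lemma isPos_smul_add_order (x : P.weylGroup) (j : ℤ) :
    b.IsPos (x • γ (j + k.order)) ↔ ¬ b.IsPos (x • γ j) := by
  rw [h.opp, isPos_opp_smul]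

/-- The linear relation between three vectors in a plane. For increasing indices all three
determinants are positive, so the middle root is a positive combination of the outer ones. -/
lemma det_mul_height {i j l : ℕ} (hi : i < k.order) (hj : j < k.order) (hl : l < k.order)
    (x : P.weylGroup) :
    ((k.fstCoord i * k.sndCoord l - k.fstCoord l * k.sndCoord i : ℤ)) * b.height (x • γ j) =
    (k.fstCoord j * k.sndCoord l - k.fstCoord l * k.sndCoord j : ℤ) * b.height (x • γ i) +
    (k.fstCoord i * k.sndCoord j - k.fstCoord j * k.sndCoord i : ℤ) * b.height (x • γ l) := by
  rw [h.height_smul x hi, h.height_smul x hj, h.height_smul x hl]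
  ring

lemma isPos_smul_of_between {i j l : ℕ} (hij : i < j) (hjl : j < l) (hl : l < k.order)
    {x : P.weylGroup} (h1 : b.IsPos (x • γ i)) (h2 : b.IsPos (x • γ l)) : b.IsPos (x • γ j) := by
  have hdet := h.det_mul_height (hij.trans (hjl.trans hl)) (hjl.trans hl) hl x
  have d1 := k.det_pos l hl i (hij.trans hjl)
  have d2 := k.det_pos l hl j hjl
  have d3 := k.det_pos j (hjl.trans hl) i hij
  zify at d1 d2 d3
  rw [b.isPos_iff] at *
  by_contra hc
  have e1 := mul_pos (sub_pos.mpr d2) h1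
  have e2 := mul_pos (sub_pos.mpr d3) h2
  have e3 := mul_nonneg (sub_pos.mpr d1).le (sub_nonneg.mpr (not_lt.mp hc))
  rw [zero_sub, mul_neg] at e3
  linarith

lemma not_isPos_smul_of_between {i j l : ℕ} (hij : i < j) (hjl : j < l) (hl : l < k.order)
    {x : P.weylGroup} (h1 : ¬ b.IsPos (x • γ i)) (h2 : ¬ b.IsPos (x • γ l)) :
    ¬ b.IsPos (x • γ j) := by
  have hdet := h.det_mul_height (hij.trans (hjl.trans hl)) (hjl.trans hl) hl x
  have d1 := k.det_pos l hl i (hij.trans hjl)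
  have d2 := k.det_pos l hl j hjl
  have d3 := k.det_pos j (hjl.trans hl) i hij
  zify at d1 d2 d3
  rw [b.isPos_iff] at *
  intro hc
  have e1 := mul_nonneg (sub_pos.mpr d2).le (sub_nonneg.mpr (not_lt.mp h1))
  have e2 := mul_nonneg (sub_pos.mpr d3).le (sub_nonneg.mpr (not_lt.mp h2))
  have e3 := mul_pos (sub_pos.mpr d1) hc
  rw [zero_sub, mul_neg] at e1 e2
  linarith

/-- A root between two roots of the same sign has that sign, so the sign changes at most once along
the half turn. -/
lemma exists_threshold (x : P.weylGroup) : ∃ q ≤ k.order,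
    (∀ j < k.order, b.IsPos (x • γ j) ↔ j < q) ∨
    (∀ j < k.order, b.IsPos (x • γ j) ↔ q ≤ j) := by
  classical
  have hm := k.two_le_order
  by_cases h0 : b.IsPos (x • γ (0 : ℕ))
  · have hex : ∃ j : ℕ, j = k.order ∨ ¬ b.IsPos (x • γ j) := ⟨_, .inl rfl⟩
    refine ⟨Nat.find hex, Nat.find_min' hex (.inl rfl),
      .inl fun j hj ↦ ⟨fun hpos ↦ ?_, fun hlt ↦ ?_⟩⟩
    · by_contra! hc
      rcases Nat.find_spec hex with h1 | h1
      · lia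
      · rcases hc.eq_or_lt with h2 | h2
        · exact h1 (h2 ▸ hpos)
        · refine h1 (h.isPos_smul_of_between (Nat.pos_of_ne_zero fun h3 ↦ ?_) h2 hj h0 hpos)
          rw [h3] at h1
          exact h1 h0
    · by_contra hc
      exact Nat.find_min hex hlt (.inr hc)
  · have hex : ∃ j : ℕ, j = k.order ∨ b.IsPos (x • γ j) := ⟨_, .inl rfl⟩
    refine ⟨Nat.find hex, Nat.find_min' hex (.inl rfl),
      .inr fun j hj ↦ ⟨fun hpos ↦ ?_, fun hle ↦ ?_⟩⟩
    · exact Nat.find_min' hex (.inr hpos)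
    · by_contra hc
      rcases Nat.find_spec hex with h1 | h1
      · lia
      · rcases hle.eq_or_lt with h2 | h2
        · exact hc (h2 ▸ h1)
        · refine h.not_isPos_smul_of_between (Nat.pos_of_ne_zero fun h3 ↦ ?_) h2 hj h0 hc h1
          rw [h3] at h1
          exact h0 h1

lemma exists_window (x : P.weylGroup) : ∃ p < 2 * k.order, h.Window x p := by
  obtain ⟨q, hq, hx⟩ := h.exists_threshold x⁻¹
  have hm := k.order_eq
  have key : ∀ p : ℕ, (∀ j : ℕ, j < k.order →
      (b.IsPos (x⁻¹ • γ j) ↔ ((j : ℤ) - p) % (2 * k.order) < k.order)) → h.Window x p := by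
    intro p hp j
    obtain ⟨t, ht⟩ : ∃ t : ℕ, (t : ℤ) = j % (2 * k.order) :=
      ⟨(j % (2 * k.order)).toNat, Int.toNat_of_nonneg (Int.emod_nonneg _ (by lia))⟩
    rw [← h.emod j, ← ht]
    by_cases htm : t < k.order
    · rw [hp t htm]
      rcases hm with hm | hm | hm | hm <;> rw [hm] at ht ⊢ <;> lia
    · have h1 : (t : ℤ) = ((t - k.order : ℕ) : ℤ) + k.order := by lia
      have h2 : t - k.order < k.order := by
        rcases hm with hm | hm | hm | hm <;> rw [hm] at ht ⊢ <;> lia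
      rw [h1, h.isPos_smul_add_order, hp _ h2]
      rcases hm with hm | hm | hm | hm <;> rw [hm] at ht htm ⊢ <;> lia
  rcases hx with hx | hx
  -- The window ends at `q - 1`, so it starts at `q - k.order`, which is `q + k.order` modulo the
  -- full turn.
  · refine ⟨(q + k.order) % (2 * k.order), Nat.mod_lt _ (by lia), key _ fun j hj ↦ ?_⟩
    rw [hx j hj]
    rcases hm with hm | hm | hm | hm <;> rw [hm] at hj hq ⊢ <;> lia
  · refine ⟨q, by lia, key _ fun j hj ↦ ?_⟩
    rw [hx j hj]
    rcases hm with hm | hm | hm | hm <;> rw [hm] at hj hq ⊢ <;> lia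

lemma window_refl_mul {x : P.weylGroup} {p : ℕ} (hp : p < 2 * k.order) (hx : h.Window x p)
    (i : ℕ) : h.Window (refl P (γ i) * x) ((2 * i + 1 + 2 * k.order - p) % (2 * k.order)) := by
  intro j
  rw [mul_inv_rev, refl_inv, mul_smul, h.refl_smul, hx, window_reflect k.order_eq hp]

lemma refl_mul_element {s : WalkState} (hs : s.rot < k.order) (i : ℕ) :
    refl P (γ i) * h.element s = h.element (s.step k i) := by
  have h1 := h.rot_pow_mul_refl_mul_rot_pow s.rot
  have h2 := h.rot_pow_order
  unfold element WalkState.step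
  rw [h.refl_eq_pow i]
  simp only
  set r := refl P (γ 0) * refl P (γ (k.order - 1)) with hr
  have h3 : r ^ i = r ^ ((i + k.order - s.rot) % k.order) * r ^ s.rot := by
    rw [← pow_eq_pow_mod (i + k.order - s.rot) h2, ← pow_add,
      Nat.sub_add_cancel (by lia), pow_add, h2, mul_one]
  rw [h3]
  split_ifs with h4 h5 h5
  · lia
  · rw [mul_one, mul_assoc, mul_assoc, ← mul_assoc (r ^ s.rot), h1]
  · calc _ = r ^ ((i + k.order - s.rot) % k.order) * (r ^ s.rot * refl P (γ 0) * r ^ s.rot) *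
          refl P (γ 0) := by simp only [mul_assoc]
      _ = _ := by rw [h1, mul_assoc, refl_mul_self]
  · lia

/-- The state `s` describes a walk ending in `x`. -/
structure Describes (u : P.weylGroup) (s : WalkState) : Prop where
  pos_lt : s.pos < 2 * k.order
  rot_lt : s.rot < k.order
  window : h.Window (h.element s * u) s.pos

lemma describes_init {u : P.weylGroup} {p : ℕ} (hp : p < 2 * k.order) (hu : h.Window u p) :
    h.Describes u (.init p) where
  pos_lt := hp
  rot_lt := by have := k.two_le_order; change 0 < _; lia
  window := by simpa [element, WalkState.init] using hu

lemma describes_step {u : P.weylGroup} {s : WalkState} (hs : h.Describes u s) (i : ℕ) :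
    h.Describes u (s.step k i) where
  pos_lt := Nat.mod_lt _ (by have := k.two_le_order; lia)
  rot_lt := Nat.mod_lt _ (by have := k.two_le_order; lia)
  window := by
    rw [← h.refl_mul_element hs.rot_lt, mul_assoc]
    exact h.window_refl_mul hs.pos_lt hs.window i

/-- The length differences telescope, and the height of a descending root is expanded in the heights
of the two simple roots of the system. -/
lemma defectSum_step {u : P.weylGroup} {s : WalkState} (hs : h.Describes u s) {i : ℕ}
    (hi : i < k.order) :
    h.defectSum u (s.step k i) = h.defectSum u s + defect b (γ i) (h.element s * u) := by
  have hw := hs.window i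
  have hp := hs.pos_lt
  have h2 := k.order_eq
  have hw' : b.IsPos ((h.element s * u)⁻¹ • γ i) ↔
      (i + 2 * k.order - s.pos) % (2 * k.order) < k.order := by
    rw [hw]
    rcases h2 with h2 | h2 | h2 | h2 <;> rw [h2] at hp ⊢ <;> lia
  have hh := h.height_smul 1 hi
  simp only [one_smul] at hh
  unfold defectSum defect
  rw [← h.refl_mul_element hs.rot_lt, ← mul_assoc]
  by_cases hc : b.IsPos ((h.element s * u)⁻¹ • γ i)
  · have hc' := hw'.mp hc
    simp only [WalkState.step, hc, hc', if_true]
    push_cast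
    ring
  · have hc' := mt hw'.mpr hc
    simp only [WalkState.step, hc, hc', if_false]
    rw [hh]
    push_cast
    ring

/-- No step has negative defect, so the total stays unchanged only if every single step is an edge.
-/
lemma foldl_step {u : P.weylGroup} {s : WalkState} (hs : h.Describes u s) {l : List ℕ}
    (hl : ∀ i ∈ l, i < k.order) :
    h.defectSum u s ≤ h.defectSum u (l.foldl (WalkState.step k) s) ∧
      walk b (h.element s * u) (l.map fun i : ℕ ↦ toRefl b (γ i)) =
        h.element (l.foldl (WalkState.step k) s) * u ∧
      (IsPath b (h.element s * u) (l.map fun i : ℕ ↦ toRefl b (γ i))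
          (h.element (l.foldl (WalkState.step k) s) * u) ↔
        h.defectSum u (l.foldl (WalkState.step k) s) = h.defectSum u s) := by
  induction l generalizing s with
  | nil => simp [isPath_nil_iff]
  | cons i l ih =>
    have hi := hl i (by simp)
    obtain ⟨h1, h2, h3⟩ := ih (h.describes_step hs i) fun j hj ↦ hl j (by simp [hj])
    have h4 := h.defectSum_step hs hi
    have h5 := defect_nonneg b (h.isPos hi) (h.element s * u)
    rw [← h.refl_mul_element hs.rot_lt, mul_assoc] at h2 h3
    simp only [List.foldl_cons, List.map_cons, walk_cons, isPath_cons_iff, coe_toRefl]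
    refine ⟨by lia, h2, ?_⟩
    rw [h3, isStep_iff_defect b (h.isPos hi)]
    lia

lemma defectSum_init (u : P.weylGroup) (p : ℕ) : h.defectSum u (.init p) = 0 := by
  simp [defectSum, WalkState.init, element]

lemma run_spec {u : P.weylGroup} {p : ℕ} (hp : p < 2 * k.order) (hu : h.Window u p)
    {l : List ℕ} (hl : ∀ i ∈ l, i < k.order) :
    0 ≤ h.defectSum u (WalkState.run k p l) ∧
      walk b u (l.map fun i : ℕ ↦ toRefl b (γ i)) = h.element (WalkState.run k p l) * u ∧
      (IsPath b u (l.map fun i : ℕ ↦ toRefl b (γ i)) (h.element (WalkState.run k p l) * u) ↔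
        h.defectSum u (WalkState.run k p l) = 0) := by
  have := h.foldl_step (h.describes_init hp hu) hl
  have h1 : h.element (.init p) * u = u := by simp [element, WalkState.init]
  rwa [h1, h.defectSum_init] at this

omit h in
lemma _root_.QuantumBruhat.WalkState.len_run (p : ℕ) (l : List ℕ) :
    (WalkState.run k p l).len = l.length := by
  suffices ∀ s : WalkState, (l.foldl (WalkState.step k) s).len = s.len + l.length by
    exact (this (.init p)).trans (Nat.zero_add _)
  induction l with
  | nil => simp
  | cons i l ih => intro s; rw [List.foldl_cons, ih]; simp [WalkState.step]; ring

lemma defectSum_lt_of_dominates {u : P.weylGroup} {s t : WalkState} (hst : t.dominates s) :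
    h.defectSum u t < h.defectSum u s := by
  simp only [WalkState.dominates, Bool.and_eq_true, beq_iff_eq, decide_eq_true_eq] at hst
  obtain ⟨⟨⟨⟨h1, h2⟩, h3⟩, h4⟩, h5⟩ := hst
  have h6 : h.element t = h.element s := by simp only [element, h1, h2]
  have h7 := b.isPos_iff.mp h.isPos_zero
  have h8 := b.isPos_iff.mp h.isPos_last
  obtain ⟨c, hc⟩ := Nat.exists_eq_add_of_le h3
  obtain ⟨d, hd⟩ := Nat.exists_eq_add_of_le h4
  unfold defectSum
  rw [h6, hc, hd]
  have h9 : (c : ℤ) * 1 ≤ c * b.height (γ 0) := mul_le_mul_of_nonneg_left (by lia) (by lia)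
  have h10 : (d : ℤ) * 1 ≤ d * b.height (γ (k.order - 1)) :=
    mul_le_mul_of_nonneg_left (by lia) (by lia)
  rw [hc, hd] at h5
  push_cast
  rw [add_mul, add_mul]
  lia

/-- A monotone walk dominating `s` would have negative total defect. -/
lemma optimal_of_defectSum_eq_zero {u : P.weylGroup} {p : ℕ} (hp : p < 2 * k.order)
    (hu : h.Window u p) {s : WalkState} (hs : h.defectSum u s = 0) : s.optimal k p = true := by
  have key : ∀ l : List ℕ, (∀ i ∈ l, i < k.order) → ¬ (WalkState.run k p l).dominates s := by
    intro l hl hd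
    have h1 := h.defectSum_lt_of_dominates (u := u) hd
    have h2 := (h.run_spec hp hu hl).1
    lia
  simp only [WalkState.optimal, WalkState.increasing, WalkState.decreasing, Bool.and_eq_true,
    Bool.not_eq_true', List.any_eq_false, List.mem_map, List.mem_sublists]
  constructor
  · rintro _ ⟨l, hl, rfl⟩
    exact key l fun i hi ↦ by simpa using hl.subset hi
  · rintro _ ⟨l, hl, rfl⟩
    exact key l fun i hi ↦ by simpa using hl.subset hi

variable (𝕜 : Type*) [Field 𝕜]

/-- The contribution of a walk with final state `s` to the expansion of a product of the
operators `R_τ` applied to `u`. -/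
def stateTerm (u : P.weylGroup) (s : WalkState) : P.weylGroup →₀ 𝕜[X] :=
  if h.defectSum u s = 0 then Finsupp.single (h.element s * u) (X ^ s.len) else 0

lemma pathTerm_eq_stateTerm {u : P.weylGroup} {p : ℕ} (hp : p < 2 * k.order)
    (hu : h.Window u p) {l : List ℕ} (hl : ∀ i ∈ l, i < k.order) :
    pathTerm b 𝕜 u (l.map fun i : ℕ ↦ toRefl b (γ i)) = h.stateTerm 𝕜 u (WalkState.run k p l) := by
  obtain ⟨-, h1, h2⟩ := h.run_spec hp hu hl
  unfold pathTerm stateTerm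
  rw [h1, List.length_map, WalkState.len_run]
  simp only [h2]

omit h in
lemma _root_.List.sum_map_filter_eq {α β : Type*} [AddCommMonoid β] (f : α → β) (p : α → Bool)
    (l : List α) (hl : ∀ a ∈ l, p a = false → f a = 0) :
    (l.map f).sum = ((l.filter p).map f).sum := by
  induction l with
  | nil => rfl
  | cons a l ih =>
    have h1 := ih fun c hc ↦ hl c (by simp [hc])
    cases hp : p a
    · simp [hp, h1, hl a (by simp) hp]
    · simp [hp, h1]

lemma sum_filter_optimal {u : P.weylGroup} {p : ℕ} (hp : p < 2 * k.order) (hu : h.Window u p)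
    (l : List WalkState) :
    (l.map (h.stateTerm 𝕜 u)).sum =
      ((l.filter (WalkState.optimal k p)).map (h.stateTerm 𝕜 u)).sum := by
  refine List.sum_map_filter_eq _ _ _ fun s _ hs ↦ ?_
  unfold stateTerm
  rw [if_neg]
  intro h0
  rw [h.optimal_of_defectSum_eq_zero hp hu h0] at hs
  exact absurd hs (by simp)

lemma pathSum_eq {u : P.weylGroup} {p : ℕ} (hp : p < 2 * k.order) (hu : h.Window u p)
    {l : List ℕ} (hl : ∀ i ∈ l, i < k.order) :
    pathSum b 𝕜 u (l.map fun i : ℕ ↦ toRefl b (γ i)) =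
      ((l.sublists.map (WalkState.run k p)).map (h.stateTerm 𝕜 u)).sum := by
  unfold pathSum
  rw [List.sublists_map, List.map_map, List.map_map]
  congr 1
  refine List.map_congr_left fun l' hl' ↦ ?_
  exact h.pathTerm_eq_stateTerm 𝕜 hp hu fun i hi ↦ hl i ((List.mem_sublists.mp hl').subset hi)

/-- The Yang–Baxter equation: the ordered products of the operators `R_τ` over the reflections of a
rank two system, taken by increasing and by decreasing angle, are equal. -/
lemma pathSum_reverse (u : P.weylGroup) :
    pathSum b 𝕜 u ((List.range k.order).map fun i : ℕ ↦ toRefl b (γ i)) =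
      pathSum b 𝕜 u ((List.range k.order).map fun i : ℕ ↦ toRefl b (γ i)).reverse := by
  obtain ⟨p, hp, hu⟩ := h.exists_window u
  rw [← List.map_reverse, h.pathSum_eq 𝕜 hp hu (by simp), h.pathSum_eq 𝕜 hp hu (by simp)]
  refine (h.sum_filter_optimal 𝕜 hp hu _).trans (Eq.trans ?_ (h.sum_filter_optimal 𝕜 hp hu _).symm)
  exact ((WalkState.perm_filter_optimal k p hp).map (h.stateTerm 𝕜 u)).sum_eq

/-- A two-step path with decreasing indices can be replaced by one with increasing indices. -/
lemma exists_increasing_path {u v : P.weylGroup} {i j : ℕ} (hi : i < k.order) (hji : j < i)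
    (hp : IsPath b u [toRefl b (γ i), toRefl b (γ j)] v) :
    ∃ i' j' : ℕ, i' < j' ∧ j' < k.order ∧ i' < i ∧
      IsPath b u [toRefl b (γ i'), toRefl b (γ j')] v := by
  obtain ⟨p, hplt, hu⟩ := h.exists_window u
  have hl : ∀ l ∈ [i, j], l < k.order := by simp; lia
  obtain ⟨-, h1, h2⟩ := h.run_spec hplt hu hl
  have hv := hp.eq_walk
  have hp' := hp
  simp only [List.map_cons, List.map_nil] at h1 h2
  rw [hv, h1, h2] at hp
  have hmem : WalkState.run k p [i, j] ∈
      (WalkState.decreasing k p).filter (WalkState.optimal k p) := by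
    refine List.mem_filter.mpr ⟨List.mem_map.mpr ⟨[i, j], ?_, rfl⟩,
      h.optimal_of_defectSum_eq_zero hplt hu hp⟩
    rw [List.mem_sublists]
    refine List.sublist_of_pairwise_of_subset (r := (· > ·)) (by simpa using hji)
      (List.pairwise_reverse.mpr List.pairwise_lt_range) ?_
    intro x hx
    simpa using hl x hx
  rw [← (WalkState.perm_filter_optimal k p hplt).mem_iff] at hmem
  obtain ⟨l, hl', hrun⟩ := List.mem_map.mp (List.mem_filter.mp hmem).1
  rw [List.mem_sublists] at hl'
  have hlen := congrArg WalkState.len hrun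
  rw [WalkState.len_run, WalkState.len_run] at hlen
  obtain ⟨i', j', rfl⟩ := List.length_eq_two.mp hlen
  have hlt : i' < j' := by
    have := (List.pairwise_lt_range (n := k.order)).sublist hl'
    simpa using this
  have hj' : j' < k.order := by simpa using hl'.subset (show j' ∈ [i', j'] by simp)
  obtain ⟨-, h3, h4⟩ := h.run_spec hplt hu (l := [i', j']) (by simp; lia)
  simp only [List.map_cons, List.map_nil] at h3 h4
  rw [hrun] at h3 h4
  refine ⟨i', j', hlt, hj', ?_, ?_⟩
  -- The rotation part of a two-step walk is the second index minus the first, so `j' - i' = j - i +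
  -- k.order`; now `j' < k.order` forces `i' < i`.
  · have hrot := congrArg WalkState.rot hrun
    simp only [WalkState.run, WalkState.init, List.foldl_cons, List.foldl_nil, WalkState.step,
      Nat.sub_zero, Nat.add_mod_right] at hrot
    rcases k.order_eq with hm | hm | hm | hm <;> rw [hm] at hrot hi hj' <;> lia
  · rw [hv, h1, h4, hp]

/-- A two-step path with increasing indices can be replaced by one with decreasing indices. -/
lemma exists_decreasing_path {u v : P.weylGroup} {i j : ℕ} (hj : j < k.order) (hij : i < j)
    (hp : IsPath b u [toRefl b (γ i), toRefl b (γ j)] v) :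
    ∃ i' j' : ℕ, j' < i' ∧ i' < k.order ∧ i < i' ∧
      IsPath b u [toRefl b (γ i'), toRefl b (γ j')] v := by
  obtain ⟨p, hplt, hu⟩ := h.exists_window u
  have hl : ∀ l ∈ [i, j], l < k.order := by simp; lia
  obtain ⟨-, h1, h2⟩ := h.run_spec hplt hu hl
  have hv := hp.eq_walk
  simp only [List.map_cons, List.map_nil] at h1 h2
  rw [hv, h1, h2] at hp
  have hmem : WalkState.run k p [i, j] ∈
      (WalkState.increasing k p).filter (WalkState.optimal k p) := by
    refine List.mem_filter.mpr ⟨List.mem_map.mpr ⟨[i, j], ?_, rfl⟩,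
      h.optimal_of_defectSum_eq_zero hplt hu hp⟩
    rw [List.mem_sublists]
    refine List.sublist_of_pairwise_of_subset (r := (· < ·)) (by simpa using hij)
      List.pairwise_lt_range ?_
    intro x hx
    simpa using hl x hx
  rw [(WalkState.perm_filter_optimal k p hplt).mem_iff] at hmem
  obtain ⟨l, hl', hrun⟩ := List.mem_map.mp (List.mem_filter.mp hmem).1
  rw [List.mem_sublists] at hl'
  have hlen := congrArg WalkState.len hrun
  rw [WalkState.len_run, WalkState.len_run] at hlen
  obtain ⟨i', j', rfl⟩ := List.length_eq_two.mp hlen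
  have hlt : j' < i' := by
    have := (List.pairwise_reverse.mpr (List.pairwise_lt_range (n := k.order))).sublist hl'
    simpa using this
  have hi' : i' < k.order := by simpa using hl'.subset (show i' ∈ [i', j'] by simp)
  obtain ⟨-, h3, h4⟩ := h.run_spec hplt hu (l := [i', j']) (by simp; lia)
  simp only [List.map_cons, List.map_nil] at h3 h4
  rw [hrun] at h3 h4
  refine ⟨i', j', hlt, hi', ?_, ?_⟩
  -- Here `j' - i' = j - i - k.order`, and `j < k.order` forces `i < i'`.
  · have hrot := congrArg WalkState.rot hrun
    simp only [WalkState.run, WalkState.init, List.foldl_cons, List.foldl_nil, WalkState.step,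
      Nat.sub_zero, Nat.add_mod_right] at hrot
    rcases k.order_eq with hm | hm | hm | hm <;> rw [hm] at hrot hi' hj <;> lia
  · rw [hv, h1, h4, hp]

end Walks

end IsRankTwoSystem

end QuantumBruhat

end

/-! ### Construction of rank two systems from pairs of positive roots. -/

noncomputable section

namespace QuantumBruhat

open RootPairing

variable {ι M N : Type*} [AddCommGroup M] [Module ℝ M] [AddCommGroup N] [Module ℝ N]
  {P : RootPairing ι ℝ M N} (b : P.Base)
  [Finite ι] [P.IsRootSystem] [P.IsCrystallographic] [P.IsReduced]

section Construction

/-- The alternating sequence of roots generated by the reflections in `a` and `c`. -/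
def dihedralSeq (P : RootPairing ι ℝ M N) (a c : ι) (j : ℤ) : ι :=
  (refl P a * refl P c) ^ (j / 2) • if j % 2 = 0 then a else refl P a • c

lemma dihedralSeq_add_two_mul (a c : ι) (j t : ℤ) :
    dihedralSeq P a c (j + 2 * t) = (refl P a * refl P c) ^ t • dihedralSeq P a c j := by
  unfold dihedralSeq
  rw [← mul_smul, ← zpow_add]
  congr 2
  · lia
  · simp

lemma dihedralSeq_add_two (a c : ι) (j : ℤ) :
    dihedralSeq P a c (j + 2) = refl P a • refl P c • dihedralSeq P a c j := by
  have := dihedralSeq_add_two_mul (P := P) a c j 1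
  rwa [mul_one, zpow_one, mul_smul] at this

lemma dihedralSeq_zero (a c : ι) : dihedralSeq P a c 0 = a := by simp [dihedralSeq]

lemma dihedralSeq_one (a c : ι) : dihedralSeq P a c 1 = refl P a • c := by
  simp [dihedralSeq]

lemma refl_mul_zpow (a c : ι) (t : ℤ) :
    refl P a * (refl P a * refl P c) ^ t = (refl P a * refl P c) ^ (-t) * refl P a := by
  have h1 : refl P a * (refl P a * refl P c) * (refl P a)⁻¹ = (refl P a * refl P c)⁻¹ := by
    rw [mul_inv_rev, refl_inv, refl_inv, refl_mul_cancel_left]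
  rw [zpow_neg, ← inv_zpow, ← h1, conj_zpow]
  group

lemma isRankTwoSystem_dihedralSeq {a c : ι} (k : RankTwoType) (ha : b.IsPos a) (hc : b.IsPos c)
    (hac : a ≠ c) (h1 : dihedralSeq P a c (k.order - 1) = c)
    (h2 : dihedralSeq P a c k.order = refl P a • a)
    (h3 : ∀ j : ℕ, j < k.order → P.root (dihedralSeq P a c j) =
      (k.fstCoord j : ℤ) • P.root a + (k.sndCoord j : ℤ) • P.root c) :
    IsRankTwoSystem b k (dihedralSeq P a c) := by
  have hparity : ∀ j : ℤ, ∃ t : ℤ, j = 0 + 2 * t ∨ j = 1 + 2 * t := fun j ↦ ⟨j / 2, by lia⟩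
  have h2' : dihedralSeq P a c (1 + k.order) = refl P (refl P a • c) • refl P a • c := by
    have : (1 + k.order : ℤ) = (k.order - 1) + 2 := by ring
    rw [this, dihedralSeq_add_two, h1, ← smul_refl_smul_self]
  -- One representative of each parity suffices, since reflection in `a` inverts the rotation; other
  -- reflections are conjugates of this one or of its product with the rotation.
  have hzero : ∀ j, refl P a • dihedralSeq P a c j = dihedralSeq P a c (k.order - j) := by
    intro j
    obtain ⟨t, rfl | rfl⟩ := hparity j
    · rw [show (k.order - (0 + 2 * t) : ℤ) = k.order + 2 * (-t) by ring, dihedralSeq_add_two_mul,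
        dihedralSeq_add_two_mul, h2, dihedralSeq_zero, ← mul_smul, refl_mul_zpow, mul_smul]
    · rw [show (k.order - (1 + 2 * t) : ℤ) = (k.order - 1) + 2 * (-t) by ring,
        dihedralSeq_add_two_mul, dihedralSeq_add_two_mul, h1, dihedralSeq_one, ← mul_smul,
        refl_mul_zpow, mul_smul, refl_smul_smul]
  refine ⟨fun j ↦ ?_, fun i j ↦ ?_, ?_, ?_, ?_, ?_⟩
  · obtain ⟨t, rfl | rfl⟩ := hparity j
    · rw [add_right_comm, dihedralSeq_add_two_mul, dihedralSeq_add_two_mul, zero_add, h2,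
        dihedralSeq_zero, smul_refl_smul_self]
    · rw [add_right_comm, dihedralSeq_add_two_mul, dihedralSeq_add_two_mul, h2', dihedralSeq_one,
        smul_refl_smul_self]
  · obtain ⟨t, rfl | rfl⟩ := hparity i
    · rw [dihedralSeq_add_two_mul, dihedralSeq_zero, refl_smul_eq_conj, mul_smul, mul_smul,
        ← zpow_neg, ← dihedralSeq_add_two_mul, hzero, ← dihedralSeq_add_two_mul]
      congr 1; ring
    · have : refl P (dihedralSeq P a c 1) = (refl P a * refl P c) ^ (1 : ℤ) * refl P a := by
        rw [dihedralSeq_one, refl_refl_smul, zpow_one]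
      rw [dihedralSeq_add_two_mul, refl_smul_eq_conj, this, mul_smul, mul_smul, mul_smul,
        ← zpow_neg, ← dihedralSeq_add_two_mul, hzero, ← dihedralSeq_add_two_mul,
        ← dihedralSeq_add_two_mul]
      congr 1; ring
  · rw [dihedralSeq_zero, h1]
    exact h3
  · rwa [dihedralSeq_zero]
  · rwa [h1]
  · rwa [dihedralSeq_zero, h1]

lemma root_refl_smul_left {a c x : ι} {p q : ℤ}
    (hx : P.root x = p • P.root a + q • P.root c) :
    P.root (refl P a • x) = (-p - q * P.pairingIn ℤ c a) • P.root a + q • P.root c := by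
  have h1 : P.pairingIn ℤ x a = p * 2 + q * P.pairingIn ℤ c a := by
    have := pairingIn_eq_add_of_root_eq_smul_add_smul (P := P) (S := ℤ) (j := a) hx
    simpa using this
  rw [refl_smul_idx, root_reflectionPerm, reflection_apply_root' ℤ, h1, hx]
  module

lemma root_refl_smul_right {a c x : ι} {p q : ℤ}
    (hx : P.root x = p • P.root a + q • P.root c) :
    P.root (refl P c • x) = p • P.root a + (-q - p * P.pairingIn ℤ a c) • P.root c := by
  rw [add_comm] at hx ⊢
  exact root_refl_smul_left hx

/-- The Cartan integers turn the alternating sequence into a linear recursion for coordinates, which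
is run through half a turn. In types `B₂` and `G₂` the root `a` is the short one. -/
lemma exists_isRankTwoSystem_of_type {a c : ι} (k : RankTwoType) (ha : b.IsPos a) (hc : b.IsPos c)
    (hac : a ≠ c)
    (hk : (k = .A₁A₁ ∧ P.pairingIn ℤ c a = 0 ∧ P.pairingIn ℤ a c = 0) ∨
      (k = .A₂ ∧ P.pairingIn ℤ c a = -1 ∧ P.pairingIn ℤ a c = -1) ∨
      (k = .B₂ ∧ P.pairingIn ℤ c a = -2 ∧ P.pairingIn ℤ a c = -1) ∨
      (k = .G₂ ∧ P.pairingIn ℤ c a = -3 ∧ P.pairingIn ℤ a c = -1)) :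
    ∃ γ, IsRankTwoSystem b k γ ∧ γ 0 = a ∧ γ (k.order - 1) = c := by
  suffices h : dihedralSeq P a c (k.order - 1) = c ∧ dihedralSeq P a c k.order = refl P a • a ∧
      ∀ j : ℕ, j < k.order → P.root (dihedralSeq P a c j) =
        (k.fstCoord j : ℤ) • P.root a + (k.sndCoord j : ℤ) • P.root c from
    ⟨_, isRankTwoSystem_dihedralSeq b k ha hc hac h.1 h.2.1 h.2.2, dihedralSeq_zero a c, h.1⟩
  have e0 : P.root (dihedralSeq P a c 0) = (1 : ℤ) • P.root a + (0 : ℤ) • P.root c := by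
    rw [dihedralSeq_zero]; module
  have e1 : P.root (dihedralSeq P a c 1) =
      (-P.pairingIn ℤ c a) • P.root a + (1 : ℤ) • P.root c := by
    rw [dihedralSeq_one, refl_smul_idx, root_reflectionPerm, reflection_apply_root' ℤ]; module
  have step : ∀ (j x y : ℤ), P.root (dihedralSeq P a c j) = x • P.root a + y • P.root c →
      P.root (dihedralSeq P a c (j + 2)) =
        (-x + (y + x * P.pairingIn ℤ a c) * P.pairingIn ℤ c a) • P.root a +
          (-y - x * P.pairingIn ℤ a c) • P.root c := by
    intro j x y hj
    rw [dihedralSeq_add_two, root_refl_smul_left (root_refl_smul_right hj)]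
    module
  have e2 := step _ _ _ e0
  have e3 := step _ _ _ e1
  have e4 := step _ _ _ e2
  have e5 := step _ _ _ e3
  have e6 := step _ _ _ e4
  have fin1 : ∀ j : ℤ, P.root (dihedralSeq P a c j) = (0 : ℤ) • P.root a + (1 : ℤ) • P.root c →
      dihedralSeq P a c j = c := fun j hj ↦ P.root.injective (by rw [hj]; module)
  have fin2 : ∀ j : ℤ, P.root (dihedralSeq P a c j) = (-1 : ℤ) • P.root a + (0 : ℤ) • P.root c →
      dihedralSeq P a c j = refl P a • a :=
    fun j hj ↦ P.root.injective (by rw [hj, refl_smul_self_root]; module)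
  rcases hk with ⟨rfl, h1, h2⟩ | ⟨rfl, h1, h2⟩ | ⟨rfl, h1, h2⟩ | ⟨rfl, h1, h2⟩ <;>
    simp only [h1, h2] at e0 e1 e2 e3 e4 e5 e6 <;> norm_num only at e0 e1 e2 e3 e4 e5 e6
  · refine ⟨fin1 1 (by simpa using e1), fin2 2 (by simpa using e2), fun j hj ↦ ?_⟩
    change j < 2 at hj
    interval_cases j <;>
      simp only [RankTwoType.fstCoord, RankTwoType.sndCoord, RankTwoType.coords] <;>
      first | exact e0 | exact e1
  · refine ⟨fin1 2 (by simpa using e2), fin2 3 (by simpa using e3), fun j hj ↦ ?_⟩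
    change j < 3 at hj
    interval_cases j <;>
      simp only [RankTwoType.fstCoord, RankTwoType.sndCoord, RankTwoType.coords] <;>
      first | exact e0 | exact e1 | exact e2
  · refine ⟨fin1 3 (by simpa using e3), fin2 4 (by simpa using e4), fun j hj ↦ ?_⟩
    change j < 4 at hj
    interval_cases j <;>
      simp only [RankTwoType.fstCoord, RankTwoType.sndCoord, RankTwoType.coords] <;>
      first | exact e0 | exact e1 | exact e2 | exact e3
  · refine ⟨fin1 5 (by simpa using e5), fin2 6 (by simpa using e6), fun j hj ↦ ?_⟩
    change j < 6 at hj
    interval_cases j <;>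
      simp only [RankTwoType.fstCoord, RankTwoType.sndCoord, RankTwoType.coords] <;>
      first | exact e0 | exact e1 | exact e2 | exact e3 | exact e4 | exact e5

lemma root_ne_neg_of_isPos {i j : ι} (hi : b.IsPos i) (hj : b.IsPos j) :
    P.root i ≠ - P.root j := by
  intro h
  rw [← refl_smul_self_root] at h
  rw [P.root.injective h, isPos_opp] at hi
  exact hi hj

lemma pairingIn_mem {i j : ι} (hi : b.IsPos i) (hj : b.IsPos j) (hij : i ≠ j) :
    (P.pairingIn ℤ i j, P.pairingIn ℤ j i) ∈
      ({(0, 0), (1, 1), (-1, -1), (1, 2), (2, 1), (-1, -2), (-2, -1), (1, 3), (3, 1), (-1, -3),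
        (-3, -1)} : Set (ℤ × ℤ)) :=
  P.pairingIn_pairingIn_mem_set_of_isCrystal_of_isRed' i j (P.root.injective.ne hij)
    (root_ne_neg_of_isPos b hi hj)

lemma exists_isRankTwoSystem_of_pairingIn_nonpos {i j : ι} (hi : b.IsPos i) (hj : b.IsPos j)
    (hij : i ≠ j) (h : P.pairingIn ℤ i j ≤ 0) :
    ∃ k γ, IsRankTwoSystem b k γ ∧
      ((γ 0 = i ∧ γ (k.order - 1) = j) ∨ (γ 0 = j ∧ γ (k.order - 1) = i)) := by
  have key : ∀ (a c : ι) (k : RankTwoType), (∃ γ, IsRankTwoSystem b k γ ∧ γ 0 = a ∧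
      γ (k.order - 1) = c) → (a = i ∧ c = j ∨ a = j ∧ c = i) → ∃ k γ, IsRankTwoSystem b k γ ∧
      ((γ 0 = i ∧ γ (k.order - 1) = j) ∨ (γ 0 = j ∧ γ (k.order - 1) = i)) := by
    rintro _ _ k ⟨γ, hγ, rfl, rfl⟩ h
    exact ⟨k, γ, hγ, h⟩
  have := pairingIn_mem b hi hj hij
  simp only [Set.mem_insert_iff, Set.mem_singleton_iff, Prod.mk.injEq] at this
  rcases this with h1 | h1 | h1 | h1 | h1 | h1 | h1 | h1 | h1 | h1 | h1
  · exact key i j _ (exists_isRankTwoSystem_of_type b .A₁A₁ hi hj hij (by simp [h1])) (by simp)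
  · lia
  · exact key i j _ (exists_isRankTwoSystem_of_type b .A₂ hi hj hij (by simp [h1])) (by simp)
  · lia
  · lia
  · exact key i j _ (exists_isRankTwoSystem_of_type b .B₂ hi hj hij (by simp [h1])) (by simp)
  · exact key j i _ (exists_isRankTwoSystem_of_type b .B₂ hj hi hij.symm (by simp [h1])) (by simp)
  · lia
  · lia
  · exact key i j _ (exists_isRankTwoSystem_of_type b .G₂ hi hj hij (by simp [h1])) (by simp)
  · exact key j i _ (exists_isRankTwoSystem_of_type b .G₂ hj hi hij.symm (by simp [h1])) (by simp)

lemma exists_isPos_refl_eq (x : ι) : ∃ y, b.IsPos y ∧ refl P y = refl P x ∧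
    b.height y = |b.height x| := by
  by_cases h : b.IsPos x
  · exact ⟨x, h, rfl, (abs_of_pos (b.isPos_iff.mp h)).symm⟩
  · refine ⟨refl P x • x, (isPos_opp b x).mpr h, refl_opp x, ?_⟩
    rw [height_opp, abs_of_nonpos]
    exact not_lt.mp h

lemma closure_refl_conj (i j : ι) :
    Subgroup.closure {refl P (refl P j • i), refl P j} = Subgroup.closure {refl P i, refl P j} := by
  rw [refl_refl_smul]
  apply le_antisymm <;> rw [Subgroup.closure_le]
  · have h1 : refl P i ∈ Subgroup.closure {refl P i, refl P j} := Subgroup.subset_closure (by simp)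
    have h2 : refl P j ∈ Subgroup.closure {refl P i, refl P j} := Subgroup.subset_closure (by simp)
    rintro _ (rfl | rfl)
    exacts [mul_mem (mul_mem h2 h1) h2, h2]
  · set K := Subgroup.closure {refl P j * refl P i * refl P j, refl P j}
    have h1 : refl P j * refl P i * refl P j ∈ K := Subgroup.subset_closure (by simp)
    have h2 : refl P j ∈ K := Subgroup.subset_closure (by simp)
    rintro _ (rfl | rfl)
    · have := mul_mem (mul_mem h2 h1) h2
      simpa only [mul_assoc, refl_mul_self, mul_one, refl_mul_cancel_left,
        SetLike.mem_coe] using this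
    · exact h2

/-- Any two positive roots lie in a rank two system whose simple reflections generate the same
group as the reflections in the two roots. -/
lemma exists_isRankTwoSystem {i j : ι} (hi : b.IsPos i) (hj : b.IsPos j) (hij : i ≠ j) :
    ∃ k γ, IsRankTwoSystem b k γ ∧ Subgroup.closure {refl P (γ 0), refl P (γ (k.order - 1))} =
      Subgroup.closure {refl P i, refl P j} := by
  -- Descent on the total height: if the pairing is positive, one root is replaced by plus or minus
  -- its reflection in the other, which preserves the generated group.
  generalize hn : (b.height i + b.height j).toNat = n
  induction n using Nat.strong_induction_on generalizing i j with
  | _ n ih =>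
    by_cases hp : P.pairingIn ℤ i j ≤ 0
    · obtain ⟨k, γ, hγ, ⟨h1, h2⟩ | ⟨h1, h2⟩⟩ :=
        exists_isRankTwoSystem_of_pairingIn_nonpos b hi hj hij hp
      · exact ⟨k, γ, hγ, by rw [h1, h2]⟩
      · exact ⟨k, γ, hγ, by rw [h1, h2, Set.pair_comm]⟩
    have hpi := b.isPos_iff.mp hi
    have hpj := b.isPos_iff.mp hj
    have hroot : ∀ x y : ι, P.root (refl P x • y) =
        (1 : ℤ) • P.root y + (-P.pairingIn ℤ y x) • P.root x := fun x y ↦ by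
      rw [refl_smul_idx, root_reflectionPerm, reflection_apply_root' ℤ]; module
    have hhi := height_eq_of_root_eq b (hroot j i)
    have hhj := height_eq_of_root_eq b (hroot i j)
    have hni := b.height_ne_zero (refl P j • i)
    have hnj := b.height_ne_zero (refl P i • j)
    have hmem := pairingIn_mem b hi hj hij
    have hne : ∀ x y z : ι, b.IsPos x → b.IsPos y → x ≠ y → refl P z = refl P (refl P x • y) →
        z ≠ x := by
      rintro x y z hx hy hxy hz rfl
      rw [refl_refl_smul, mul_assoc, left_eq_mul] at hz
      have h1 : refl P y = refl P z := by rw [eq_inv_of_mul_eq_one_left hz, refl_inv]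
      exact hxy ((toRefl_inj b hx hy).mp (Subtype.ext h1.symm))
    obtain ⟨x, hx, hxr, hxh⟩ := exists_isPos_refl_eq b (refl P j • i)
    obtain ⟨y, hy, hyr, hyh⟩ := exists_isPos_refl_eq b (refl P i • j)
    -- With pairings `p, q > 0`, failure of both would give `p * ht j ≥ 2 * ht i` and `q * ht i ≥ 2
    -- * ht j`, hence `p * q ≥ 4`; but `p * q ≤ 3`.
    have hcase : b.height x < b.height i ∨ b.height y < b.height j := by
      rw [hxh, hyh, abs_lt, abs_lt]
      simp only [Set.mem_insert_iff, Set.mem_singleton_iff, Prod.mk.injEq] at hmem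
      rcases hmem with h1 | h1 | h1 | h1 | h1 | h1 | h1 | h1 | h1 | h1 | h1 <;>
        rw [h1.1] at hhi <;> rw [h1.2] at hhj <;> lia
    have hxp := b.isPos_iff.mp hx
    have hyp := b.isPos_iff.mp hy
    rcases hcase with hc | hc
    · obtain ⟨k, γ, hγ, h⟩ := ih _ (by lia) hx hj (hne j i x hj hi hij.symm hxr) rfl
      refine ⟨k, γ, hγ, h.trans ?_⟩
      rw [hxr, closure_refl_conj]
    · obtain ⟨k, γ, hγ, h⟩ := ih _ (by lia) hi hy (hne i j y hi hj hij hyr).symm rfl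
      refine ⟨k, γ, hγ, h.trans ?_⟩
      rw [hyr, Set.pair_comm, closure_refl_conj, Set.pair_comm]

end Construction

end QuantumBruhat

end

/-! ### Dihedral reflection subgroups and monotone numberings. -/

noncomputable section

namespace QuantumBruhat

open RootPairing

variable {ι M N : Type*} [AddCommGroup M] [Module ℝ M] [AddCommGroup N] [Module ℝ N]
  {P : RootPairing ι ℝ M N} {b : P.Base}
  [Finite ι] [P.IsRootSystem] [P.IsCrystallographic] [P.IsReduced]

section Dihedral

lemma linearIndependent_of_isPos {i j : ι} (hi : b.IsPos i) (hj : b.IsPos j) (hij : i ≠ j) :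
    LinearIndependent ℝ ![P.root i, P.root j] :=
  IsReduced.linearIndependent P hij (root_ne_neg_of_isPos b hi hj)

lemma coord_unique_of_isPos {i j : ι} (hi : b.IsPos i) (hj : b.IsPos j) (hij : i ≠ j)
    {x y x' y' : ℤ} (h : x • P.root i + y • P.root j = x' • P.root i + y' • P.root j) :
    x = x' ∧ y = y' := by
  have hlin := linearIndependent_of_isPos hi hj hij
  rw [LinearIndependent.pair_iff] at hlin
  have h1 : ((x - x' : ℤ) : ℝ) • P.root i + ((y - y' : ℤ) : ℝ) • P.root j = 0 := by
    rw [Int.cast_smul_eq_zsmul, Int.cast_smul_eq_zsmul, sub_smul, sub_smul, ← sub_eq_zero.mpr h]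
    abel
  have h2 := hlin _ _ h1
  norm_cast at h2
  lia

lemma eq_of_refl_smul_eq_opp {x y : ι} (hx : b.IsPos x) (hy : b.IsPos y)
    (h : refl P x • y = refl P y • y) : x = y := by
  by_contra hne
  have h1 := congrArg P.root h
  rw [refl_smul_self_root, refl_smul_idx, root_reflectionPerm, reflection_apply_root' ℤ] at h1
  have h2 := coord_unique_of_isPos hx hy hne (x := 0) (y := 2) (x' := P.pairingIn ℤ y x) (y' := 0)
    (by
      rw [sub_eq_iff_eq_add, ← sub_eq_iff_eq_add'] at h1
      rw [← h1]
      module)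
  lia

namespace IsRankTwoSystem

variable {k : RankTwoType} {γ : ℤ → ι} (h : IsRankTwoSystem b k γ)
include h

lemma coord_unique {x y x' y' : ℤ} (hxy : x • P.root (γ 0) + y • P.root (γ (k.order - 1)) =
    x' • P.root (γ 0) + y' • P.root (γ (k.order - 1))) : x = x' ∧ y = y' :=
  coord_unique_of_isPos h.isPos_zero h.isPos_last h.ne hxy

lemma root_eq_add_iff {i j l : ℕ} (hi : i < k.order) (hj : j < k.order) (hl : l < k.order) :
    P.root (γ j) = P.root (γ i) + P.root (γ l) ↔
      k.fstCoord j = k.fstCoord i + k.fstCoord l ∧ k.sndCoord j = k.sndCoord i + k.sndCoord l := by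
  rw [h.root_eq i hi, h.root_eq j hj, h.root_eq l hl]
  constructor
  · intro hr
    have := h.coord_unique (x := k.fstCoord j) (y := k.sndCoord j)
      (x' := k.fstCoord i + k.fstCoord l) (y' := k.sndCoord i + k.sndCoord l) (by rw [hr]; module)
    lia
  · rintro ⟨h1, h2⟩
    rw [h1, h2]
    push_cast
    module

lemma injOn : Set.InjOn (fun j : ℕ ↦ γ j) (Set.Iio (2 * k.order)) := by
  have key : ∀ i j : ℕ, i < j → j < k.order → γ i ≠ γ j := by
    intro i j hij hj he
    have h1 := h.root_eq j hj
    rw [← he, h.root_eq i (hij.trans hj)] at h1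
    have h2 := h.coord_unique h1
    have h3 := k.det_pos j hj i hij
    norm_cast at h2
    rw [h2.1, h2.2] at h3
    exact lt_irrefl _ h3
  have hopp : ∀ j : ℕ, γ ((j + k.order : ℕ) : ℤ) = refl P (γ j) • γ j := fun j ↦ by
    rw [← h.opp]; push_cast; rfl
  have key' : ∀ i j : ℕ, i < j → j < 2 * k.order → γ i ≠ γ j := by
    intro i j hij hj he
    by_cases h1 : j < k.order
    · exact key i j hij h1 he
    obtain ⟨j, rfl⟩ := Nat.exists_eq_add_of_le' (not_lt.mp h1)
    rw [hopp] at he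
    by_cases h2 : i < k.order
    · have h3 := h.isPos h2
      rw [he, isPos_opp] at h3
      exact h3 (h.isPos (by lia))
    · obtain ⟨i, rfl⟩ := Nat.exists_eq_add_of_le' (not_lt.mp h2)
      rw [hopp] at he
      refine key i j (by lia) (by lia) (P.root.injective ?_)
      have := congrArg P.root he
      rwa [refl_smul_self_root, refl_smul_self_root, neg_inj] at this
  intro i hi j hj hij
  by_contra hne
  rcases lt_or_gt_of_ne hne with hlt | hlt
  · exact key' i j hlt hj hij
  · exact key' j i hlt hi hij.symm

lemma rot_zpow_smul (e j : ℤ) :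
    (refl P (γ 0) * refl P (γ (k.order - 1))) ^ e • γ j = γ (j + 2 * e) := by
  have hinv (j : ℤ) : (refl P (γ 0) * refl P (γ (k.order - 1)))⁻¹ • γ j = γ (j - 2) := by
    rw [inv_smul_eq_iff, h.rot_smul, sub_add_cancel]
  induction e generalizing j with
  | zero => simp
  | succ e ih =>
    rw [zpow_add_one, mul_smul, h.rot_smul, ih]
    congr 1; ring
  | pred e ih =>
    rw [zpow_sub_one, mul_smul, hinv, ih]
    congr 1; ring

lemma exists_of_mem_closure {g : P.weylGroup}
    (hg : g ∈ Subgroup.closure {refl P (γ 0), refl P (γ (k.order - 1))}) :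
    ∃ e : ℕ, e < k.order ∧ (g = (refl P (γ 0) * refl P (γ (k.order - 1))) ^ e ∨
      g = refl P (γ e)) := by
  have hm := k.two_le_order
  suffices hs : ∃ e : ℤ, g = (refl P (γ 0) * refl P (γ (k.order - 1))) ^ e ∨
      g = (refl P (γ 0) * refl P (γ (k.order - 1))) ^ e * refl P (γ 0) by
    obtain ⟨e, he⟩ := hs
    obtain ⟨t, ht⟩ : ∃ t : ℕ, (t : ℤ) = e % k.order :=
      ⟨(e % k.order).toNat, Int.toNat_of_nonneg (Int.emod_nonneg _ (by lia))⟩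
    have h1 := Int.emod_lt_of_pos e (b := k.order) (by lia)
    refine ⟨t, by lia, ?_⟩
    rw [h.refl_eq_pow]
    have h2 : (refl P (γ 0) * refl P (γ (k.order - 1))) ^ e =
        (refl P (γ 0) * refl P (γ (k.order - 1))) ^ t := by
      rw [← zpow_natCast, ht, ← Int.emod_add_mul_ediv e k.order, zpow_add, zpow_mul,
        zpow_natCast _ k.order, h.rot_pow_order, one_zpow, mul_one]
      simp
    rwa [h2] at he
  have hmul : ∀ x ∈ ({refl P (γ 0), refl P (γ (k.order - 1))} : Set P.weylGroup), ∀ y,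
      (∃ e : ℤ, y = (refl P (γ 0) * refl P (γ (k.order - 1))) ^ e ∨
        y = (refl P (γ 0) * refl P (γ (k.order - 1))) ^ e * refl P (γ 0)) →
      ∃ e : ℤ, x * y = (refl P (γ 0) * refl P (γ (k.order - 1))) ^ e ∨
        x * y = (refl P (γ 0) * refl P (γ (k.order - 1))) ^ e * refl P (γ 0) := by
    have hlast : ∀ e : ℤ, refl P (γ (k.order - 1)) *
        (refl P (γ 0) * refl P (γ (k.order - 1))) ^ e =
        (refl P (γ 0) * refl P (γ (k.order - 1))) ^ (-(1 + e)) * refl P (γ 0) := by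
      intro e
      rw [← refl_mul_zpow, zpow_add, zpow_one, mul_assoc, refl_mul_cancel_left]
    rintro _ (rfl | rfl) y ⟨e, rfl | rfl⟩
    · exact ⟨-e, .inr (refl_mul_zpow _ _ _)⟩
    · exact ⟨-e, .inl (by rw [← mul_assoc, refl_mul_zpow, mul_assoc, refl_mul_self, mul_one])⟩
    · exact ⟨_, .inr (hlast e)⟩
    · exact ⟨_, .inl (by rw [← mul_assoc, hlast, mul_assoc, refl_mul_self, mul_one])⟩
  induction hg using Subgroup.closure_induction_left with
  | one => exact ⟨0, by simp⟩
  | mul_left x hx y _ ih => exact hmul x hx y ih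
  | inv_mul_cancel x hx y _ ih =>
    have hinv : x⁻¹ = x := by rcases hx with rfl | rfl <;> exact refl_inv _
    rw [hinv]
    exact hmul x hx y ih

lemma refl_mem_closure {j : ℕ} :
    refl P (γ j) ∈ Subgroup.closure {refl P (γ 0), refl P (γ (k.order - 1))} := by
  rw [h.refl_eq_pow]
  have h1 : refl P (γ 0) ∈ Subgroup.closure {refl P (γ 0), refl P (γ (k.order - 1))} :=
    Subgroup.subset_closure (by simp)
  exact mul_mem (pow_mem (mul_mem h1 (Subgroup.subset_closure (by simp))) _) h1

/-- A rotation that is an involution or trivial is the identity or the half turn. A reflection in a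
root is not the identity, and it cannot negate two different positive roots. -/
lemma rot_pow_ne_refl {x : ι} (hx : b.IsPos x) (e : ℕ) (he : e < k.order) :
    refl P x ≠ (refl P (γ 0) * refl P (γ (k.order - 1))) ^ e := by
  intro hxe
  have hact : ∀ j : ℤ, refl P x • γ j = γ (j + 2 * e) := fun j ↦ by
    rw [hxe, ← zpow_natCast, h.rot_zpow_smul]
  have h1 : γ ((4 * e % (2 * k.order) : ℕ) : ℤ) = γ ((0 : ℕ) : ℤ) := by
    have := hact (2 * e)
    have h0 := hact 0
    push_cast
    rw [h.emod, ← refl_smul_smul (P := P) x (γ 0), h0, zero_add, this]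
    congr 1; ring
  have h2 := h.injOn (Nat.mod_lt _ (by lia)) (by simp; lia) h1
  rcases Nat.eq_zero_or_pos e with rfl | hpos
  · rw [pow_zero] at hxe
    have := (isPos_opp b x).mp (by rwa [hxe, one_smul])
    exact this hx
  · have h3 : 2 * e = k.order := by
      obtain ⟨c, hc⟩ := Nat.dvd_of_mod_eq_zero h2
      have : c = 1 := by nlinarith
      subst this; lia
    have h4 : ∀ j : ℤ, refl P x • γ j = refl P (γ j) • γ j := fun j ↦ by
      rw [hact, ← h.opp]; congr 1; lia
    exact h.ne ((eq_of_refl_smul_eq_opp hx h.isPos_zero (h4 0)).symm.trans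
      (eq_of_refl_smul_eq_opp hx h.isPos_last (h4 _)))

lemma exists_eq_of_refl_mem {x : ι} (hx : b.IsPos x)
    (hmem : refl P x ∈ Subgroup.closure {refl P (γ 0), refl P (γ (k.order - 1))}) :
    ∃ t : ℕ, t < k.order ∧ x = γ t := by
  obtain ⟨e, he, h1 | h1⟩ := h.exists_of_mem_closure hmem
  · exact absurd h1 (h.rot_pow_ne_refl hx e he)
  · exact ⟨e, he, (toRefl_inj b hx (h.isPos he)).mp (Subtype.ext h1)⟩

lemma last_eq : (((k.order - 1 : ℕ) : ℤ)) = k.order - 1 := by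
  have := k.two_le_order
  lia

/-- By `exists_eq_of_refl_mem` the positive roots of the subgroup are exactly the listed ones, so
indecomposability is read off the coordinate tables. -/
lemma canonicalGenerators_eq :
    canonicalGenerators b (Subgroup.closure {refl P (γ 0), refl P (γ (k.order - 1))}) =
      {refl P (γ 0), refl P (γ (k.order - 1))} := by
  have hm := k.two_le_order
  have hmem : ∀ j : ℕ, j < k.order →
      γ j ∈ posRootsOf b (Subgroup.closure {refl P (γ 0), refl P (γ (k.order - 1))}) :=
    fun j hj ↦ ⟨h.isPos hj, h.refl_mem_closure⟩
  ext g
  constructor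
  · rintro ⟨i, ⟨hi, hiH⟩, hind, rfl⟩
    obtain ⟨t, ht, rfl⟩ := h.exists_eq_of_refl_mem hi hiH
    by_cases h0 : t = 0
    · simp [h0]
    by_cases h1 : t = k.order - 1
    · right; rw [h1, h.last_eq]; rfl
    obtain ⟨p, hp, q, hq, hpq⟩ := k.exists_add t ht h0 h1
    exact absurd ((h.root_eq_add_iff hp ht hq).mpr hpq) (hind _ (hmem p hp) _ (hmem q hq))
  · have key : ∀ t : ℕ, t < k.order → (∀ p < k.order, ∀ q < k.order,
        ¬ (k.fstCoord t = k.fstCoord p + k.fstCoord q ∧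
          k.sndCoord t = k.sndCoord p + k.sndCoord q)) →
        refl P (γ t) ∈ canonicalGenerators b
          (Subgroup.closure {refl P (γ 0), refl P (γ (k.order - 1))}) := by
      intro t ht hnot
      refine ⟨γ t, hmem t ht, ?_, rfl⟩
      rintro j ⟨hj, hjH⟩ l ⟨hl, hlH⟩ hr
      obtain ⟨p, hp, rfl⟩ := h.exists_eq_of_refl_mem hj hjH
      obtain ⟨q, hq, rfl⟩ := h.exists_eq_of_refl_mem hl hlH
      exact hnot p hp q hq ((h.root_eq_add_iff hp ht hq).mp hr)
    rintro (rfl | rfl)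
    · exact key 0 (by lia) fun p hp q hq ↦ (k.not_add_of_last p hp q hq).1
    · have := key (k.order - 1) (by lia) fun p hp q hq ↦ (k.not_add_of_last p hp q hq).2
      rwa [h.last_eq] at this

lemma orderOf_rot : orderOf (refl P (γ 0) * refl P (γ (k.order - 1))) = k.order := by
  have hm := k.two_le_order
  refine (orderOf_eq_iff (by lia)).mpr ⟨h.rot_pow_order, fun t ht hpos hone ↦ ?_⟩
  have h1 := h.rot_zpow_smul t 0
  rw [zpow_natCast, hone, one_smul] at h1
  have h2 : 0 = 2 * t := h.injOn (by simp; lia) (by simp; lia) (by simpa using h1)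
  lia

end IsRankTwoSystem

/-- A numbering of the reflections is monotone on rank two systems if it is increasing or
decreasing along the positive roots of each of them, listed by increasing angle. -/
def IsMonotoneOnSystems (b : P.Base) {α : Type*} [Preorder α] (φ : reflections b → α) : Prop :=
  ∀ k γ, IsRankTwoSystem b k γ →
    StrictMonoOn (fun j : ℕ ↦ φ (toRefl b (γ j))) (Set.Iio k.order) ∨
      StrictAntiOn (fun j : ℕ ↦ φ (toRefl b (γ j))) (Set.Iio k.order)

/-- The alternating sequence of the canonical generators runs through the reflections in `γ 0, γ 1,
…`. The rest of the argument uses only this form of the hypothesis. -/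
lemma IsReflectionOrdering.isMonotoneOnSystems {n : ℕ} {φ : reflections b ≃ Fin n}
    (hφ : IsReflectionOrdering b φ) : IsMonotoneOnSystems b φ := by
  intro k γ h
  have key := hφ (Subgroup.closure {refl P (γ 0), refl P (γ (k.order - 1))})
    ⟨{refl P (γ 0), refl P (γ (k.order - 1))}, by
      rintro _ (rfl | rfl) <;> exact refl_mem_reflections b _, rfl⟩
    (toRefl b (γ 0)) (toRefl b (γ (k.order - 1)))
    (fun he ↦ h.ne ((toRefl_inj b h.isPos_zero h.isPos_last).mp he))
    h.canonicalGenerators_eq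
  have halt : ∀ j : ℕ, alternating b (toRefl b (γ 0)) (toRefl b (γ (k.order - 1))) j =
      toRefl b (γ j) := fun j ↦ Subtype.ext (h.refl_eq_pow j).symm
  simpa only [halt, coe_toRefl, h.orderOf_rot] using key

/-- Any two positive roots lie in a rank two system. -/
lemma exists_isRankTwoSystem_mem {x y : ι} (hx : b.IsPos x) (hy : b.IsPos y) (hxy : x ≠ y) :
    ∃ k γ, IsRankTwoSystem b k γ ∧ (∃ i : ℕ, i < k.order ∧ x = γ i) ∧
      (∃ j : ℕ, j < k.order ∧ y = γ j) ∧
      ∀ z, b.IsPos z → refl P z ∈ Subgroup.closure {refl P x, refl P y} →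
        ∃ l : ℕ, l < k.order ∧ z = γ l := by
  obtain ⟨k, γ, h, hcl⟩ := exists_isRankTwoSystem b hx hy hxy
  have key : ∀ z, b.IsPos z → refl P z ∈ Subgroup.closure {refl P x, refl P y} →
      ∃ l : ℕ, l < k.order ∧ z = γ l := fun z hz hzmem ↦ h.exists_eq_of_refl_mem hz (hcl ▸ hzmem)
  exact ⟨k, γ, h, key x hx (Subgroup.subset_closure (by simp)),
    key y hy (Subgroup.subset_closure (by simp)), key⟩

/-- The reflections in `x` and `y` may generate too small a group, as for orthogonal short roots in
`B₂`. If one of the pairings of `x` and `y` is `-1`, then `z` is a reflected root; otherwise `z`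
reflects `y` to `-x`, and `y`, `z` serve as generators. -/
lemma exists_isRankTwoSystem_of_root_eq_add {x y z : ι} (hx : b.IsPos x) (hy : b.IsPos y)
    (hz : b.IsPos z) (h : P.root z = P.root x + P.root y) :
    ∃ k γ, IsRankTwoSystem b k γ ∧ (∃ i : ℕ, i < k.order ∧ x = γ i) ∧
      (∃ j : ℕ, j < k.order ∧ z = γ j) ∧ (∃ l : ℕ, l < k.order ∧ y = γ l) := by
  have conj_mem : ∀ i j, refl P (refl P j • i) ∈ Subgroup.closure {refl P i, refl P j} := by
    intro i j
    rw [← closure_refl_conj]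
    exact Subgroup.subset_closure (by simp)
  have hroot : ∀ x y : ι, P.root (refl P x • y) =
      P.root y - P.pairingIn ℤ y x • P.root x := fun x y ↦ by
    rw [refl_smul_idx, root_reflectionPerm, reflection_apply_root' ℤ]
  have hxy : x ≠ y := by
    rintro rfl
    have : IsAddTorsionFree M := .of_isTorsionFree ℝ M
    exact P.nsmul_notMem_range_root (n := 2) (i := x) ⟨z, by rw [h, two_nsmul]⟩
  have hzy : z ≠ y := by
    rintro rfl
    exact P.ne_zero x (by simpa using h)
  by_cases h1 : P.pairingIn ℤ x y = -1
  · have h2 : refl P y • x = z := P.root.injective (by rw [hroot, h1, h]; module)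
    obtain ⟨k, γ, hγ, hxγ, hyγ, hall⟩ := exists_isRankTwoSystem_mem hx hy hxy
    exact ⟨k, γ, hγ, hxγ, hall z hz (h2 ▸ conj_mem x y), hyγ⟩
  by_cases h3 : P.pairingIn ℤ y x = -1
  · have h2 : refl P x • y = z := P.root.injective (by rw [hroot, h3, h]; module)
    obtain ⟨k, γ, hγ, hyγ, hxγ, hall⟩ := exists_isRankTwoSystem_mem hy hx hxy.symm
    exact ⟨k, γ, hγ, hxγ, hall z hz (h2 ▸ conj_mem y x), hyγ⟩
  have h4 : P.pairingIn ℤ z y = P.pairingIn ℤ x y + 2 := by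
    have := pairingIn_eq_add_of_root_eq_add (S := ℤ) (j := y) h
    simpa using this
  have h5 : P.pairingIn ℤ y z = 1 := by
    have m1 := pairingIn_mem b hx hy hxy
    have m2 := pairingIn_mem b hz hy hzy
    simp only [Set.mem_insert_iff, Set.mem_singleton_iff, Prod.mk.injEq] at m1 m2
    have m3 : 0 ≤ P.pairingIn ℤ x y := by
      rcases m1 with m | m | m | m | m | m | m | m | m | m | m <;> lia
    rcases m2 with m | m | m | m | m | m | m | m | m | m | m <;> lia
  have h6 : refl P (refl P z • y) = refl P x := by
    rw [← refl_opp x]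
    congr 1
    exact P.root.injective (by rw [hroot, h5, refl_smul_self_root, h]; module)
  obtain ⟨k, γ, hγ, hyγ, hzγ, hall⟩ := exists_isRankTwoSystem_mem hy hz hzy.symm
  exact ⟨k, γ, hγ, hall x hx (h6 ▸ conj_mem y z), hzγ, hyγ⟩

lemma IsMonotoneOnSystems.between {α : Type*} [Preorder α] {φ : reflections b → α}
    (hφ : IsMonotoneOnSystems b φ) {x y z : ι} (hx : b.IsPos x) (hy : b.IsPos y)
    (hz : b.IsPos z) (h : P.root z = P.root x + P.root y) :
    φ (toRefl b x) < φ (toRefl b z) ∧ φ (toRefl b z) < φ (toRefl b y) ∨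
      φ (toRefl b y) < φ (toRefl b z) ∧ φ (toRefl b z) < φ (toRefl b x) := by
  obtain ⟨k, γ, hγ, ⟨i, hi, rfl⟩, ⟨j, hj, rfl⟩, ⟨l, hl, rfl⟩⟩ :=
    exists_isRankTwoSystem_of_root_eq_add hx hy hz h
  have hb := k.between_of_add i hi j hj l hl ((hγ.root_eq_add_iff hi hj hl).mp h)
  rcases hφ k γ hγ with hm | hm <;> rcases hb with ⟨h1, h2⟩ | ⟨h1, h2⟩
  · exact .inl ⟨hm hi hj h1, hm hj hl h2⟩
  · exact .inr ⟨hm hl hj h1, hm hj hi h2⟩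
  · exact .inr ⟨hm hj hl h2, hm hi hj h1⟩
  · exact .inl ⟨hm hj hi h2, hm hl hj h1⟩

end Dihedral

end QuantumBruhat

end

/-! ### Inversion sequences and independence of the reduced word. -/

noncomputable section

namespace QuantumBruhat

open RootPairing

variable {ι M N : Type*} [AddCommGroup M] [Module ℝ M] [AddCommGroup N] [Module ℝ N]
  {P : RootPairing ι ℝ M N} (b : P.Base)
  [Finite ι] [P.IsRootSystem] [P.IsCrystallographic] [P.IsReduced]

section Chains

/-- `IsInversionSeq b w L`: there is a reduced expression `s₁ ⋯ sₙ` of `w` such that `L` is the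
sequence of the reflections `s₁, s₁s₂s₁, …, s₁ ⋯ sₙ ⋯ s₁`. -/
inductive IsInversionSeq : P.weylGroup → List (reflections b) → Prop
  | nil : IsInversionSeq 1 []
  | snoc {w : P.weylGroup} {L : List (reflections b)} {i : ι} (hL : IsInversionSeq w L)
      (hi : i ∈ b.support) (hw : b.IsPos (w • i)) :
      IsInversionSeq (w * refl P i) (L ++ [toRefl b (w • i)])

variable {b}

lemma IsInversionSeq.len_eq {w : P.weylGroup} {L : List (reflections b)}
    (h : IsInversionSeq b w L) : len b w = L.length := by
  induction h with
  | nil => exact len_one b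
  | snoc _ hi hw ih => rw [len_mul_refl_of_isPos b hi hw, ih]; simp

/-- The first reflection of the inversion sequence of a reduced word is its first letter. -/
lemma exists_isInversionSeq_of_word (l : List ι) (hl : ∀ i ∈ l, i ∈ b.support)
    (hred : l.length ≤ len b (l.map (refl P)).prod) :
    ∃ L, IsInversionSeq b (l.map (refl P)).prod L ∧
      ∀ i l', l = i :: l' → ∃ L', L = toRefl b i :: L' := by
  induction l using List.reverseRecOn with
  | nil => exact ⟨[], .nil, by simp⟩
  | append_singleton l i ih =>
    have hi : i ∈ b.support := hl i (by simp)
    simp only [List.map_append, List.map_cons, List.map_nil, List.prod_append, List.prod_singleton,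
      List.length_append, List.length_singleton] at hred ⊢
    have hle : len b (l.map (refl P)).prod ≤ l.length := by
      simpa using len_le_of_prod b (l := l.map (refl P)) (by
        simp only [List.mem_map, forall_exists_index, and_imp, forall_apply_eq_imp_iff₂]
        exact fun j hj ↦ refl_mem_simpleReflections b (hl j (by simp [hj])))
    have hpos : b.IsPos ((l.map (refl P)).prod • i) := by
      by_contra hneg
      have := len_mul_refl_of_not_isPos b hi hneg
      lia
    rw [len_mul_refl_of_isPos b hi hpos] at hred
    obtain ⟨L, hL, hhead⟩ := ih (fun j hj ↦ hl j (by simp [hj])) (by lia)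
    refine ⟨_, hL.snoc hi hpos, fun j l' hjl ↦ ?_⟩
    cases l with
    | nil =>
      simp only [List.nil_append, List.cons.injEq] at hjl
      have : L = [] := List.eq_nil_of_length_eq_zero (by rw [← hL.len_eq]; simp [len_one])
      exact ⟨[], by simp [this, hjl.1]⟩
    | cons a l =>
      obtain ⟨L', rfl⟩ := hhead a l rfl
      simp only [List.cons_append, List.cons.injEq] at hjl
      exact ⟨_, by rw [hjl.1]; rfl⟩

lemma exists_reduced_idx_word (w : P.weylGroup) :
    ∃ l : List ι, (∀ i ∈ l, i ∈ b.support) ∧ (l.map (refl P)).prod = w ∧ l.length = len b w := by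
  obtain ⟨l, hl, rfl, hlen⟩ := exists_reduced_word b w
  suffices ∃ l' : List ι, (∀ i ∈ l', i ∈ b.support) ∧ l'.map (refl P) = l by
    obtain ⟨l', hl', rfl⟩ := this
    exact ⟨l', hl', rfl, by rw [← hlen, List.length_map]⟩
  clear hlen
  induction l with
  | nil => exact ⟨[], by simp⟩
  | cons s l ih =>
    obtain ⟨l', hl', rfl⟩ := ih fun s hs ↦ hl s (by simp [hs])
    obtain ⟨i, hi, rfl⟩ := hl s (by simp)
    exact ⟨i :: l', by simpa [hi] using hl', rfl⟩

lemma exists_isInversionSeq (w : P.weylGroup) : ∃ L, IsInversionSeq b w L := by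
  obtain ⟨l, hl, rfl, hlen⟩ := exists_reduced_idx_word (b := b) w
  obtain ⟨L, hL, -⟩ := exists_isInversionSeq_of_word l hl hlen.le
  exact ⟨L, hL⟩

/-- An element with `w⁻¹ αᵢ` negative has an inversion sequence that starts with `sᵢ`. -/
lemma exists_isInversionSeq_cons {w : P.weylGroup} {i : ι} (hi : i ∈ b.support)
    (hw : ¬ b.IsPos (w⁻¹ • i)) : ∃ L, IsInversionSeq b w (toRefl b i :: L) := by
  have h1 := len_refl_simple_mul_of_not_isPos b hi hw
  obtain ⟨l, hl, hprod, hlen⟩ := exists_reduced_idx_word (b := b) (refl P i * w)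
  have h2 : ((i :: l).map (refl P)).prod = w := by
    rw [List.map_cons, List.prod_cons, hprod, refl_mul_cancel_left]
  obtain ⟨L, hL, hhead⟩ := exists_isInversionSeq_of_word (i :: l)
    (List.forall_mem_cons.mpr ⟨hi, hl⟩)
    (by rw [h2, List.length_cons, hlen]; exact h1.le)
  obtain ⟨L', rfl⟩ := hhead i l rfl
  exact ⟨L', h2 ▸ hL⟩

end Chains

section Alternating

/-- The product of `n` factors, alternately the reflections in `p` and `q`, starting with `p`. -/
def altProd (P : RootPairing ι ℝ M N) (p q : ι) (n : ℕ) : P.weylGroup :=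
  (refl P p * refl P q) ^ (n / 2) * if n % 2 = 0 then 1 else refl P p

/-- The `n`-th factor of the alternating product. -/
def altIdx (p q : ι) (n : ℕ) : ι := if n % 2 = 0 then p else q

lemma altProd_succ (p q : ι) (n : ℕ) :
    altProd P p q (n + 1) = altProd P p q n * refl P (altIdx p q n) := by
  rcases Nat.mod_two_eq_zero_or_one n with h | h
  · have h1 : (n + 1) % 2 = 1 := by lia
    have h2 : (n + 1) / 2 = n / 2 := by lia
    simp [altProd, altIdx, h, h1, h2]
  · have h1 : (n + 1) % 2 = 0 := by lia
    have h2 : (n + 1) / 2 = n / 2 + 1 := by lia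
    simp [altProd, altIdx, h, h1, h2, pow_succ, mul_assoc]

lemma altProd_smul_altIdx {p q : ι} {δ : ℕ → ι} (h0 : δ 0 = p) (h1 : δ 1 = refl P p • q)
    (h2 : ∀ j, δ (j + 2) = refl P p • refl P q • δ j) (n : ℕ) :
    altProd P p q n • altIdx p q n = δ n := by
  induction n using Nat.twoStepInduction with
  | zero => simp [altProd, altIdx, h0]
  | one => simp [altProd, altIdx, h1]
  | more n ih _ =>
    rw [h2, ← ih, ← mul_smul, ← mul_smul]
    unfold altProd altIdx
    rw [Nat.add_mod_right, show (n + 2) / 2 = n / 2 + 1 by lia, pow_succ', mul_assoc]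

lemma altProd_eq_altProd {p q : ι} {m : ℕ} (h : (refl P p * refl P q) ^ m = 1) :
    altProd P p q m = altProd P q p m := by
  unfold altProd
  set r := refl P p * refl P q with hr
  have h1 : refl P q * refl P p = r⁻¹ := by
    rw [hr, mul_inv_rev, refl_inv, refl_inv]
  have h2 : refl P q = r⁻¹ * refl P p := by
    rw [← h1, mul_assoc, refl_mul_self, mul_one]
  rw [h1]
  have h3 := Nat.div_add_mod m 2
  split_ifs with h4
  · rw [mul_one, mul_one, inv_pow, eq_inv_iff_mul_eq_one, ← pow_add]
    rwa [← two_mul, ← Nat.add_zero (2 * _), ← h4, h3]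
  · rw [h2, ← mul_assoc, ← pow_succ, inv_pow]
    congr 1
    rw [eq_inv_iff_mul_eq_one, ← pow_add]
    convert h using 2
    lia

lemma IsInversionSeq.append_alternating {b : P.Base} {x : P.weylGroup} {L : List (reflections b)}
    (hL : IsInversionSeq b x L) {p q : ι} (hp : p ∈ b.support) (hq : q ∈ b.support) {δ : ℕ → ι}
    (h0 : δ 0 = p) (h1 : δ 1 = refl P p • q) (h2 : ∀ j, δ (j + 2) = refl P p • refl P q • δ j)
    (n : ℕ) (hpos : ∀ j < n, b.IsPos (x • δ j)) :
    IsInversionSeq b (x * altProd P p q n)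
      (L ++ (List.range n).map fun j ↦ toRefl b (x • δ j)) := by
  induction n with
  | zero => simpa [altProd] using hL
  | succ n ih =>
    have hδ := altProd_smul_altIdx h0 h1 h2 n
    have := (ih fun j hj ↦ hpos j (by lia)).snoc (i := altIdx p q n)
      (by unfold altIdx; split_ifs <;> assumption)
      (by rw [mul_smul, hδ]; exact hpos n (by lia))
    rw [mul_smul, hδ, mul_assoc, ← altProd_succ] at this
    simpa [List.range_succ] using this

end Alternating

namespace IsRankTwoSystem

variable {b} {k : RankTwoType} {γ : ℤ → ι} (h : IsRankTwoSystem b k γ)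
include h

/-- The image of a rank two system under an element that keeps its simple roots positive. -/
lemma smul {x : P.weylGroup} (h0 : b.IsPos (x • γ 0)) (h1 : b.IsPos (x • γ (k.order - 1))) :
    IsRankTwoSystem b k fun j ↦ x • γ j where
  opp j := by rw [h.opp, smul_refl_smul_self]
  refl_smul i j := by
    rw [refl_smul_eq_conj, mul_smul, mul_smul, inv_smul_smul, h.refl_smul]
  root_eq j hj := by
    simp only [root_smul_idx, h.root_eq j hj, smul_add]
    congr 1 <;> simp only [← Int.cast_smul_eq_zsmul ℝ] <;> exact smul_comm _ _ _
  isPos_zero := h0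
  isPos_last := h1
  ne he := h.ne ((smul_left_cancel_iff x).mp he)

lemma isPos_smul {x : P.weylGroup} (h0 : b.IsPos (x • γ 0)) (h1 : b.IsPos (x • γ (k.order - 1)))
    {j : ℕ} (hj : j < k.order) : b.IsPos (x • γ j) :=
  (h.smul h0 h1).isPos hj

end IsRankTwoSystem

section Matsumoto

variable {b} {A : Type*} [Monoid A] {f : reflections b → A}

/-- The Yang-Baxter equations for a function on the reflections. -/
def IsYangBaxter (f : reflections b → A) : Prop :=
  ∀ k γ, IsRankTwoSystem b k γ →
    ((List.range k.order).map fun j : ℕ ↦ f (toRefl b (γ j))).prod =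
      (((List.range k.order).map fun j : ℕ ↦ f (toRefl b (γ j))).reverse).prod

/-- Having both descents, `w` is `x` times the longest element of the dihedral group, where `x`
keeps both simple roots positive. An inversion sequence of `x` extends to `w` by the roots `x • γ j`
in either order, one for each last letter. Yang–Baxter for the translated system equates the two
products, and induction handles every other sequence with the same last letter. -/
lemma IsYangBaxter.prod_eq_of_simple (hf : IsYangBaxter f) {k : RankTwoType} {γ : ℤ → ι}
    (h : IsRankTwoSystem b k γ) (h0 : γ 0 ∈ b.support) (h1 : γ (k.order - 1) ∈ b.support)
    {w : P.weylGroup} (hw0 : ¬ b.IsPos (w • γ 0)) (hw1 : ¬ b.IsPos (w • γ (k.order - 1)))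
    (ih : ∀ u : P.weylGroup, len b u < len b w → ∀ L L', IsInversionSeq b u L →
      IsInversionSeq b u L' → (L.map f).prod = (L'.map f).prod) :
    ∃ a : A, ∀ i ∈ ({γ 0, γ (k.order - 1)} : Set ι), ∀ u L, IsInversionSeq b u L →
      u * refl P i = w → b.IsPos (u • i) → (L.map f).prod * f (toRefl b (u • i)) = a := by
  have hm := k.two_le_order
  set p := γ 0 with hp
  set q := γ (k.order - 1) with hq
  set m := k.order with hmdef
  let δ : ℕ → ι := fun j ↦ γ j
  let δ' : ℕ → ι := fun j ↦ γ (m - 1 - j)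
  have hd0 : δ 0 = p := rfl
  have hd1 : δ 1 = refl P p • q := by
    change γ 1 = _
    rw [hp, hq, h.refl_smul]; congr 1; ring
  have hd2 : ∀ j, δ (j + 2) = refl P p • refl P q • δ j := fun j ↦ by
    rw [← mul_smul, hp, hq, h.rot_smul]; simp [δ]
  have he0 : δ' 0 = q := by simp [δ', hq]
  have he1 : δ' 1 = refl P q • p := by
    change γ (m - 1 - (1 : ℕ)) = _
    rw [hp, hq, h.refl_smul, ← h.add_two_mul_order]
    congr 1; push_cast; ring
  have he2 : ∀ j, δ' (j + 2) = refl P q • refl P p • δ' j := fun j ↦ by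
    have h3 := h.rot_smul (m - 1 - (j + 2 : ℕ))
    rw [mul_smul] at h3
    have h4 : δ' j = refl P p • refl P q • δ' (j + 2) := by
      simp only [δ']
      rw [h3]; congr 1; push_cast; ring
    rw [h4, refl_smul_smul, refl_smul_smul]
  have hend : altProd P p q m = altProd P q p m := altProd_eq_altProd h.rot_pow_order
  have hinv : ∀ (p q : ι) (δ : ℕ → ι), δ 0 = p → δ 1 = refl P p • q →
      (∀ j, δ (j + 2) = refl P p • refl P q • δ j) →
      (altProd P p q m)⁻¹ • δ (m - 1) = refl P (altIdx p q (m - 1)) • altIdx p q (m - 1) := by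
    intro p q δ h0 h1 h2
    rw [← altProd_smul_altIdx h0 h1 h2, show m = m - 1 + 1 by lia, altProd_succ,
      Nat.add_sub_cancel, mul_inv_rev, refl_inv, mul_smul, inv_smul_smul]
  set x := w * (altProd P p q m)⁻¹ with hx
  have hpos : ∀ i, (i = p ∨ i = q) → b.IsPos (w • refl P i • i) := by
    rintro i (rfl | rfl) <;> rw [isPos_opp_smul] <;> assumption
  have hidx : ∀ (p q : ι) (n : ℕ), altIdx p q n = p ∨ altIdx p q n = q := fun p q n ↦ by
    unfold altIdx; split_ifs <;> simp
  have hx0 : b.IsPos (x • γ 0) := by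
    have h3 := hinv q p δ' he0 he1 he2
    have h4 : δ' (m - 1) = γ 0 := by simp only [δ']; congr 1; lia
    rw [hx, mul_smul, hend, ← h4, h3]
    exact hpos _ (hidx q p _).symm
  have hx1 : b.IsPos (x • γ (k.order - 1)) := by
    have h3 := hinv p q δ hd0 hd1 hd2
    have h4 : δ (m - 1) = γ (k.order - 1) := by simp only [δ]; congr 1; lia
    rw [hx, mul_smul, ← h4, h3]
    exact hpos _ (hidx p q _)
  have hxw : x * altProd P p q m = w := by rw [hx, inv_mul_cancel_right]
  obtain ⟨L₀, hL₀⟩ := exists_isInversionSeq (b := b) x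
  have key : ∀ (p q : ι) (δ : ℕ → ι), p ∈ b.support → q ∈ b.support → δ 0 = p →
      δ 1 = refl P p • q → (∀ j, δ (j + 2) = refl P p • refl P q • δ j) →
      (∀ j < m, b.IsPos (x • δ j)) → x * altProd P p q m = w →
      ∀ u L, IsInversionSeq b u L → u * refl P (altIdx p q (m - 1)) = w →
        b.IsPos (u • altIdx p q (m - 1)) →
        (L.map f).prod * f (toRefl b (u • altIdx p q (m - 1))) = (L₀.map f).prod *
          ((List.range m).map fun j ↦ f (toRefl b (x • δ j))).prod := by
    intro p q δ hp hq h0 h1 h2 hδ hxw u L hL hu hupos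
    have hI := hL₀.append_alternating hp hq h0 h1 h2 (m - 1) fun j hj ↦ hδ j (by lia)
    have hux : u = x * altProd P p q (m - 1) := by
      rw [show m = m - 1 + 1 by lia, altProd_succ, ← mul_assoc, ← hu] at hxw
      exact (mul_right_cancel hxw).symm
    have hlen := len_mul_refl_of_isPos b (i := altIdx p q (m - 1))
      (by rcases hidx p q (m - 1) with h | h <;> rw [h] <;> assumption) hupos
    rw [hu] at hlen
    rw [ih u (by lia) L _ hL (hux ▸ hI), hux, mul_smul, altProd_smul_altIdx h0 h1 h2]
    conv_rhs => rw [show m = m - 1 + 1 by lia, List.range_succ]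
    simp [mul_assoc, Function.comp_def]
  have hrev : ((List.range m).map fun j ↦ f (toRefl b (x • δ' j))).prod =
      ((List.range m).map fun j ↦ f (toRefl b (x • δ j))).prod := by
    rw [hf k _ (h.smul hx0 hx1)]
    congr 1
    refine List.ext_getElem (by simp [hmdef]) fun n h3 h4 ↦ ?_
    simp only [List.getElem_map, List.getElem_range, List.getElem_reverse, List.length_map,
      List.length_range, δ']
    simp only [List.length_map, List.length_range] at h3
    congr 4
    lia
  have k1 := key p q δ h0 h1 hd0 hd1 hd2 (fun j hj ↦ h.isPos_smul hx0 hx1 hj) hxw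
  have k2 := key q p δ' h1 h0 he0 he1 he2 (fun j hj ↦ by
    have := h.isPos_smul hx0 hx1 (j := m - 1 - j) (by lia)
    convert this using 3
    lia) (hend ▸ hxw)
  refine ⟨(L₀.map f).prod * ((List.range m).map fun j ↦ f (toRefl b (x • δ j))).prod, ?_⟩
  rw [hrev] at k2
  -- The parity of `m` decides which alternating word ends in which letter.
  have hlast : altIdx p q (m - 1) = p ∧ altIdx q p (m - 1) = q ∨
      altIdx p q (m - 1) = q ∧ altIdx q p (m - 1) = p := by
    unfold altIdx; split_ifs <;> simp
  rcases hlast with ⟨e1, e2⟩ | ⟨e1, e2⟩ <;> rw [e1] at k1 <;> rw [e2] at k2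
  · rintro i (rfl | rfl)
    exacts [k1, k2]
  · rintro i (rfl | rfl)
    exacts [k2, k1]

/-- The product along an inversion sequence of a solution of the Yang-Baxter equations depends only
on the element of the Weyl group. -/
lemma IsYangBaxter.prod_eq (hf : IsYangBaxter f) {w : P.weylGroup} {L L' : List (reflections b)}
    (hL : IsInversionSeq b w L) (hL' : IsInversionSeq b w L') :
    (L.map f).prod = (L'.map f).prod := by
  generalize hn : len b w = n
  induction n using Nat.strong_induction_on generalizing w L L' with
  | _ n ih =>
    subst hn
    have hlen := hL.len_eq.symm.trans hL'.len_eq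
    rcases hL with _ | @⟨u, L, i, hL, hi, hu⟩
    · have : L' = [] := List.eq_nil_of_length_eq_zero (by simpa using hlen.symm)
      rw [this]
    generalize hw : u * refl P i = w at *
    rcases hL' with _ | @⟨u', L', j, hL', hj, hu'⟩
    · simp at hlen
    have ih' : ∀ v : P.weylGroup, len b v < len b (u' * refl P j) → ∀ L L',
        IsInversionSeq b v L → IsInversionSeq b v L' → (L.map f).prod = (L'.map f).prod :=
      fun v hv L L' h h' ↦ ih _ hv h h' rfl
    simp only [List.map_append, List.map_cons, List.map_nil, List.prod_append, List.prod_singleton]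
    by_cases hij : i = j
    · subst hij
      have := mul_right_cancel hw
      subst this
      rw [ih' u (by rw [len_mul_refl_of_isPos b hi hu]; lia) L L' hL hL']
    have hneg : ∀ (v : P.weylGroup) (l : ι), b.IsPos (v • l) → ¬ b.IsPos ((v * refl P l) • l) := by
      intro v l hv
      rw [mul_smul, isPos_opp_smul, not_not]
      exact hv
    have hnj := hneg u' j hu'
    have hni := hneg u i hu
    rw [hw] at hni
    -- Distinct simple roots have nonpositive pairing, so they are themselves the simple roots of a
    -- rank two system.
    obtain ⟨k, γ, hγ, hc⟩ := exists_isRankTwoSystem_of_pairingIn_nonpos b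
      (Base.isPos_of_mem_support hi) (Base.isPos_of_mem_support hj) hij
      (b.pairingIn_le_zero_of_ne hij hi hj)
    obtain ⟨a, ha⟩ : ∃ a : A, ∀ l ∈ ({γ 0, γ (k.order - 1)} : Set ι), ∀ v L, IsInversionSeq b v L →
        v * refl P l = u' * refl P j → b.IsPos (v • l) →
          (L.map f).prod * f (toRefl b (v • l)) = a := by
      rcases hc with ⟨rfl, rfl⟩ | ⟨rfl, rfl⟩
      · exact hf.prod_eq_of_simple hγ hi hj hni hnj ih'
      · exact hf.prod_eq_of_simple hγ hj hi hnj hni ih'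
    rw [ha i (by rcases hc with ⟨rfl, rfl⟩ | ⟨rfl, rfl⟩ <;> simp) u L hL hw hu,
      ha j (by rcases hc with ⟨rfl, rfl⟩ | ⟨rfl, rfl⟩ <;> simp) u' L' hL' rfl hu']

end Matsumoto

end QuantumBruhat

end

/-! ### Reflection orderings as inversion sequences, and counting of monotone paths. -/

noncomputable section

namespace QuantumBruhat

open RootPairing Polynomial

variable {ι M N : Type*} [AddCommGroup M] [Module ℝ M] [AddCommGroup N] [Module ℝ N]
  {P : RootPairing ι ℝ M N} {b : P.Base}
  [Finite ι] [P.IsRootSystem] [P.IsCrystallographic] [P.IsReduced]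

section Orderings

lemma exists_root_eq_add {i : ι} (hi : b.IsPos i) (h : i ∉ b.support) :
    ∃ x y, b.IsPos x ∧ b.IsPos y ∧ P.root i = P.root x + P.root y := by
  obtain ⟨j, hj, hij⟩ := hi.exists_mem_support_pos_pairingIn
  rw [P.zero_lt_pairingIn_iff'] at hij
  obtain ⟨x, hx⟩ := P.root_sub_root_mem_of_pairingIn_pos hij (by rintro rfl; exact h hj)
  exact ⟨x, j, hi.sub hj hx, Base.isPos_of_mem_support hj, by rw [hx]; abel⟩

lemma isPos_refl_smul_iff {i j : ι} (hi : i ∈ b.support) (hij : j ≠ i) (hij' : refl P i • j ≠ i) :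
    b.IsPos (refl P i • j) ↔ b.IsPos j := by
  constructor
  · intro h
    have := h.reflectionPerm hi hij'
    rwa [← refl_smul_idx, refl_smul_smul] at this
  · intro h
    exact h.reflectionPerm hi hij

/-- Reversal interchanges increasing and decreasing paths, so each claim needs proof for one kind
only. -/
lemma isMonotoneOnSystems_rev {n : ℕ} {φ : reflections b ≃ Fin n} (hφ : IsMonotoneOnSystems b φ) :
    IsMonotoneOnSystems b (φ.trans Fin.revPerm) := by
  intro k γ h
  refine (hφ k γ h).symm.imp (fun hm i hi j hj hij ↦ ?_) (fun hm i hi j hj hij ↦ ?_)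
  · simpa using hm hi hj hij
  · simpa using hm hi hj hij

/-- The roots of an initial section of a reflection ordering are the inversions of an element of
the Weyl group. -/
lemma IsMonotoneOnSystems.exists_isInversionSeq_take {n : ℕ} {φ : reflections b ≃ Fin n}
    (hφ : IsMonotoneOnSystems b φ) (k : ℕ) (hk : k ≤ n) :
    ∃ w, IsInversionSeq b w ((List.ofFn φ.symm).take k) ∧
      ∀ i, b.IsPos i → (b.IsPos (w⁻¹ • i) ↔ k ≤ φ (toRefl b i)) := by
  induction k with
  | zero => exact ⟨1, .nil, fun i hi ↦ by simpa using hi⟩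
  | succ k ih =>
    obtain ⟨w, hw, hinv⟩ := ih (by lia)
    obtain ⟨β, hβ, hβk⟩ := exists_toRefl b (φ.symm ⟨k, by lia⟩)
    have hφβ : (φ (toRefl b β) : ℕ) = k := by rw [hβk]; simp
    have hpos : b.IsPos (w⁻¹ • β) := (hinv β hβ).mpr hφβ.ge
    have hneg : ∀ x, b.IsPos x → b.IsPos (w • x) → k ≤ φ (toRefl b (w • x)) := fun x hx hwx ↦
      (hinv _ hwx).mp (by rwa [inv_smul_smul])
    -- Otherwise `β` is a sum of `w • x` and `w • y` with `x`, `y` positive. If both summands are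
    -- positive, both labels are at least `k`, yet that of `β` lies strictly between. If `w • y` is
    -- negative, its negative is labelled below `k`, and `w • x` lies between it and `β`, although
    -- its label is at least `k`.
    have hsimple : w⁻¹ • β ∈ b.support := by
      by_contra hnot
      obtain ⟨x, y, hx, hy, hxy⟩ := exists_root_eq_add hpos hnot
      have hsum := smul_idx_add (w := w) hxy
      rw [smul_inv_smul] at hsum
      have key : ∀ x y, b.IsPos x → b.IsPos y → P.root β = P.root (w • x) + P.root (w • y) →
          b.IsPos (w • x) → False := by
        intro x y hx hy hsum hwx
        have h1 := hneg x hx hwx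
        by_cases hwy : b.IsPos (w • y)
        · have h2 := hneg y hy hwy
          rcases hφ.between hwx hwy hβ hsum with ⟨h3, h4⟩ | ⟨h3, h4⟩ <;>
            rw [Fin.lt_def] at h3 h4 <;> lia
        · have hpos' : b.IsPos (w • refl P y • y) := (isPos_opp_smul b w y).mpr hwy
          have hroot : P.root (w • refl P y • y) = - P.root (w • y) := by
            rw [smul_refl_smul_self, refl_smul_self_root]
          have h2 : ¬ k ≤ φ (toRefl b (w • refl P y • y)) := by
            rw [← hinv _ hpos', inv_smul_smul, isPos_opp, not_not]
            exact hy
          rcases hφ.between hβ hpos' hwx (by rw [hroot, hsum]; abel) with ⟨h3, h4⟩ | ⟨h3, h4⟩ <;>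
            rw [Fin.lt_def] at h3 h4 <;> lia
      by_cases hwx : b.IsPos (w • x)
      · exact key x y hx hy hsum hwx
      · by_cases hwy : b.IsPos (w • y)
        · exact key y x hy hx (by rw [hsum, add_comm]) hwy
        · have h1 := height_eq_of_root_eq b (i := w • x) (j := w • y) (x := 1) (y := 1) (k := β)
            (by rw [hsum]; module)
          rw [Base.isPos_iff] at hwx hwy hβ
          lia
    refine ⟨w * refl P (w⁻¹ • β), ?_, fun i hi ↦ ?_⟩
    · have h1 := hw.snoc hsimple (by rwa [smul_inv_smul])
      rw [smul_inv_smul] at h1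
      convert h1 using 1
      rw [← List.take_concat_get' _ _ (by simpa using hk)]
      simp [hβk]
    · rw [mul_inv_rev, refl_inv, mul_smul]
      by_cases hiβ : i = β
      · subst hiβ
        rw [isPos_opp, hφβ]
        simp [hpos]
      · have hφi : (φ (toRefl b i) : ℕ) ≠ k := fun he ↦ hiβ <| by
          rw [← hφβ, Fin.val_inj, φ.apply_eq_iff_eq, toRefl_inj b hi hβ] at he
          exact he
        rw [isPos_refl_smul_iff hsimple, hinv i hi]
        · lia
        · exact fun he ↦ hiβ (smul_left_cancel _ he)
        · intro he
          have h1 := congrArg (refl P (w⁻¹ • β) • ·) he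
          simp only [refl_smul_smul] at h1
          rw [← smul_refl_smul_self, smul_left_cancel_iff] at h1
          rw [h1, isPos_opp] at hi
          exact hi hβ

lemma IsMonotoneOnSystems.exists_isInversionSeq {n : ℕ} {φ : reflections b ≃ Fin n}
    (hφ : IsMonotoneOnSystems b φ) :
    ∃ w, IsInversionSeq b w (List.ofFn φ.symm) ∧ ∀ i, b.IsPos i → ¬ b.IsPos (w⁻¹ • i) := by
  obtain ⟨w, hw, hinv⟩ := hφ.exists_isInversionSeq_take n le_rfl
  refine ⟨w, by rwa [List.take_of_length_le (by simp)] at hw, fun i hi ↦ ?_⟩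
  rw [hinv i hi]
  exact not_le.mpr (φ _).isLt

/-- The ordering is an inversion sequence of an element making every positive root negative; such an
element also has a reduced word starting with the given simple reflection. -/
lemma IsMonotoneOnSystems.exists_prod_eq_mul {A : Type*} [Monoid A] {f : reflections b → A}
    (hf : IsYangBaxter f) {n : ℕ} {φ : reflections b ≃ Fin n} (hφ : IsMonotoneOnSystems b φ)
    {i : ι} (hi : i ∈ b.support) :
    ∃ a : A, ((List.ofFn φ.symm).map f).prod = f (toRefl b i) * a := by
  obtain ⟨w, hw, hneg⟩ := hφ.exists_isInversionSeq
  obtain ⟨L, hL⟩ := exists_isInversionSeq_cons hi (hneg i (Base.isPos_of_mem_support hi))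
  exact ⟨(L.map f).prod, by rw [hf.prod_eq hw hL, List.map_cons, List.prod_cons]⟩

lemma IsYangBaxter.op {A : Type*} [Monoid A] {f : reflections b → A} (hf : IsYangBaxter f) :
    IsYangBaxter fun τ ↦ MulOpposite.op (f τ) := by
  intro k γ h
  have h1 := congrArg MulOpposite.op (hf k γ h)
  rw [MulOpposite.op_list_prod, MulOpposite.op_list_prod, List.map_reverse, List.reverse_reverse,
    List.map_map] at h1
  exact h1.symm

/-- The previous factorization for the reversed ordering in the opposite monoid. -/
lemma IsMonotoneOnSystems.exists_prod_eq_mul' {A : Type*} [Monoid A] {f : reflections b → A}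
    (hf : IsYangBaxter f) {n : ℕ} {φ : reflections b ≃ Fin n} (hφ : IsMonotoneOnSystems b φ)
    {i : ι} (hi : i ∈ b.support) :
    ∃ a : A, ((List.ofFn φ.symm).map f).prod = a * f (toRefl b i) := by
  obtain ⟨a, ha⟩ := (isMonotoneOnSystems_rev hφ).exists_prod_eq_mul hf.op hi
  refine ⟨a.unop, ?_⟩
  have h1 : (List.ofFn (φ.trans Fin.revPerm).symm) = (List.ofFn φ.symm).reverse := by
    refine List.ext_getElem (by simp) fun j h1 h2 ↦ ?_
    simp only [List.getElem_ofFn, List.getElem_reverse, List.length_ofFn]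
    change φ.symm (Fin.rev _) = _
    congr 1
    ext
    rw [Fin.val_rev]
    lia
  have h2 := congrArg MulOpposite.unop ha
  rw [h1, MulOpposite.unop_list_prod, List.map_map, List.map_reverse, List.reverse_reverse] at h2
  exact h2

variable (b) in
lemma isYangBaxter_opR (𝕜 : Type*) [Field 𝕜] : IsYangBaxter (opR b 𝕜) := by
  intro k γ h
  refine Finsupp.lhom_ext' fun u ↦ LinearMap.ext_ring ?_
  have h1 := prod_opR_single b 𝕜 u ((List.range k.order).map fun i : ℕ ↦ toRefl b (γ i))
  have h2 := prod_opR_single b 𝕜 u ((List.range k.order).map fun i : ℕ ↦ toRefl b (γ i)).reverse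
  rw [List.reverse_reverse, h.pathSum_reverse, ← h1, List.map_reverse, List.map_map] at h2
  exact h2.symm

end Orderings

section Counting

/-- The value of a coefficient at `ε = 1`. -/
def evalOne (𝕜 : Type*) [Field 𝕜] (x : P.weylGroup →₀ 𝕜[X]) (v : P.weylGroup) : 𝕜 := (x v).eval 1

open Classical in
/-- The number of the sublists of `l` that form a path from `u` to `v`. -/
def pathCount (b : P.Base) (l : List (reflections b)) (u v : P.weylGroup) : ℕ :=
  l.sublists.countP fun l' ↦ IsPath b u l' v

lemma evalOne_pathSum (𝕜 : Type*) [Field 𝕜] (l : List (reflections b)) (u v : P.weylGroup) :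
    evalOne 𝕜 (pathSum b 𝕜 u l) v = pathCount b l u v := by
  classical
  have hterm : ∀ l', ((pathTerm b 𝕜 u l') v).eval 1 = if IsPath b u l' v then (1 : 𝕜) else 0 := by
    intro l'
    unfold pathTerm
    by_cases h : IsPath b u l' v
    · have := h.eq_walk
      subst this
      simp [h]
    · rw [if_neg h]
      split_ifs with h1
      · rw [Finsupp.single_apply, if_neg (by rintro rfl; exact h h1)]
        simp
      · simp
  unfold evalOne pathSum pathCount
  induction l.sublists with
  | nil => simp
  | cons l' L ih =>
    rw [List.map_cons, List.sum_cons, Finsupp.add_apply, eval_add, ih, hterm, List.countP_cons]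
    push_cast
    rw [add_comm]
    congr 1
    simp

lemma evalOne_opR_simple (𝕜 : Type*) [Field 𝕜] {i : ι} (hi : i ∈ b.support)
    (x : P.weylGroup →₀ 𝕜[X]) (v : P.weylGroup) :
    evalOne 𝕜 (opR b 𝕜 (toRefl b i) x) v = evalOne 𝕜 x v + evalOne 𝕜 x (refl P i * v) := by
  classical
  unfold evalOne
  induction x using Finsupp.induction_linear with
  | zero => simp
  | add x y hx hy => simp only [map_add, Finsupp.add_apply, eval_add, hx, hy]; ring
  | single w a =>
    rw [opR_single, if_pos (isStep_simple b hi w), Finsupp.add_apply, eval_add]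
    congr 1
    have : (refl P i * w = v) ↔ w = refl P i * v := by
      constructor <;> rintro rfl <;> rw [refl_mul_cancel_left]
    rw [Finsupp.single_apply, Finsupp.single_apply, coe_toRefl]
    simp only [this]
    split_ifs <;> simp

/-- At `ε = 1` the product lies in the image of `1 + s`, whose elements have `s`-invariant
coefficients. In `pathCount_refl_mul_left` the factor `1 + s` acts first and does not distinguish
`u` from `su`. -/
lemma IsMonotoneOnSystems.pathCount_refl_mul_right {n : ℕ} {φ : reflections b ≃ Fin n}
    (hφ : IsMonotoneOnSystems b φ) {i : ι} (hi : i ∈ b.support) (u v : P.weylGroup) :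
    pathCount b (List.ofFn φ.symm).reverse u (refl P i * v) =
      pathCount b (List.ofFn φ.symm).reverse u v := by
  obtain ⟨a, ha⟩ := hφ.exists_prod_eq_mul (isYangBaxter_opR b ℚ) hi
  have h1 := prod_opR_single b ℚ u (List.ofFn φ.symm)
  rw [ha, Module.End.mul_apply] at h1
  have h2 : (pathCount b (List.ofFn φ.symm).reverse u (refl P i * v) : ℚ) =
      pathCount b (List.ofFn φ.symm).reverse u v := by
    rw [← evalOne_pathSum, ← evalOne_pathSum, ← h1, evalOne_opR_simple ℚ hi,
      evalOne_opR_simple ℚ hi, refl_mul_cancel_left, add_comm]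
  exact_mod_cast h2

lemma IsMonotoneOnSystems.pathCount_refl_mul_left {n : ℕ} {φ : reflections b ≃ Fin n}
    (hφ : IsMonotoneOnSystems b φ) {i : ι} (hi : i ∈ b.support) (u v : P.weylGroup) :
    pathCount b (List.ofFn φ.symm).reverse (refl P i * u) v =
      pathCount b (List.ofFn φ.symm).reverse u v := by
  classical
  obtain ⟨a, ha⟩ := hφ.exists_prod_eq_mul' (isYangBaxter_opR b ℚ) hi
  have h1 : ∀ u, evalOne ℚ (pathSum b ℚ u (List.ofFn φ.symm).reverse) v =
      evalOne ℚ (a (Finsupp.single u 1)) v + evalOne ℚ (a (Finsupp.single (refl P i * u) 1)) v := by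
    intro u
    have h2 : Finsupp.single (refl P i * u) (X : ℚ[X]) =
        (X : ℚ[X]) • Finsupp.single (refl P i * u) 1 := by simp
    rw [← prod_opR_single, ha, Module.End.mul_apply, opR_single, if_pos (isStep_simple b hi u),
      map_add, one_mul, coe_toRefl, h2, map_smul]
    simp [evalOne]
  have h2 : (pathCount b (List.ofFn φ.symm).reverse (refl P i * u) v : ℚ) =
      pathCount b (List.ofFn φ.symm).reverse u v := by
    rw [← evalOne_pathSum, ← evalOne_pathSum, h1, h1, refl_mul_cancel_left, add_comm]
  exact_mod_cast h2

lemma IsMonotoneOnSystems.pathCount_eq {n : ℕ} {φ : reflections b ≃ Fin n}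
    (hφ : IsMonotoneOnSystems b φ) (u v : P.weylGroup) :
    pathCount b (List.ofFn φ.symm).reverse u v = pathCount b (List.ofFn φ.symm).reverse 1 1 := by
  obtain ⟨l, hl, rfl, -⟩ := exists_reduced_idx_word (b := b) u
  obtain ⟨l', hl', rfl, -⟩ := exists_reduced_idx_word (b := b) v
  have h1 : ∀ v, pathCount b (List.ofFn φ.symm).reverse (l.map (refl P)).prod v =
      pathCount b (List.ofFn φ.symm).reverse 1 v := by
    intro v
    induction l with
    | nil => rfl
    | cons i l ih =>
      rw [List.map_cons, List.prod_cons, hφ.pathCount_refl_mul_left (hl i (by simp)),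
        ih fun j hj ↦ hl j (by simp [hj])]
  rw [h1]
  clear h1 hl
  induction l' with
  | nil => rfl
  | cons i l ih =>
    rw [List.map_cons, List.prod_cons, hφ.pathCount_refl_mul_right (hl' i (by simp)),
      ih fun j hj ↦ hl' j (by simp [hj])]

lemma IsPath.len_le {u v : P.weylGroup} {l : List (reflections b)} (h : IsPath b u l v) :
    len b v ≤ len b u + l.length := by
  induction l generalizing u with
  | nil => rw [(isPath_nil_iff b).mp h]; simp
  | cons τ l ih =>
    rw [isPath_cons_iff] at h
    have h1 := ih h.2
    rw [List.length_cons]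
    rcases h.1 with h2 | ⟨h2, -⟩ <;> lia

/-- The count is constant. The empty path from `1` to `1` makes it positive. An edge raises the
length by at most one, so a path from `1` to the element of length `n` must use the whole list,
which bounds the count by one. -/
lemma IsMonotoneOnSystems.pathCount_eq_one {n : ℕ} {φ : reflections b ≃ Fin n}
    (hφ : IsMonotoneOnSystems b φ) (u v : P.weylGroup) :
    pathCount b (List.ofFn φ.symm).reverse u v = 1 := by
  classical
  obtain ⟨w, hw, -⟩ := hφ.exists_isInversionSeq
  have h1 : 0 < pathCount b (List.ofFn φ.symm).reverse 1 1 := by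
    refine List.countP_pos_iff.mpr ⟨[], by simp, ?_⟩
    simp [isPath_nil_iff]
  have h2 : pathCount b (List.ofFn φ.symm).reverse 1 w ≤ 1 := by
    have hnodup : (List.ofFn φ.symm).reverse.Nodup := by
      rw [List.nodup_reverse]
      exact List.nodup_ofFn_ofInjective φ.symm.injective
    refine le_trans ?_ (List.nodup_iff_count_le_one.mp (List.nodup_sublists.mpr hnodup)
      (List.ofFn φ.symm).reverse)
    unfold pathCount
    rw [List.count]
    refine List.countP_mono_left fun l' hl' hp ↦ ?_
    have h3 := (of_decide_eq_true hp).len_le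
    rw [hw.len_eq, len_one, zero_add] at h3
    simpa using (List.mem_sublists.mp hl').eq_of_length_le (by simpa using h3)
  rw [hφ.pathCount_eq] at h2 ⊢
  lia

end Counting

end QuantumBruhat

end

/-! ### Uniqueness, minimality and the product formula. -/

noncomputable section

namespace QuantumBruhat

open RootPairing Polynomial

variable {ι M N : Type*} [AddCommGroup M] [Module ℝ M] [AddCommGroup N] [Module ℝ N]
  {P : RootPairing ι ℝ M N} {b : P.Base}
  [Finite ι] [P.IsRootSystem] [P.IsCrystallographic] [P.IsReduced]
  {n : ℕ} {φ : reflections b ≃ Fin n}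

section Uniqueness

lemma sublist_reverse_ofFn_iff {l : List (reflections b)} :
    l.Sublist (List.ofFn φ.symm).reverse ↔ (l.map φ).Pairwise (· > ·) := by
  have hfull : (List.ofFn φ.symm).reverse.Pairwise fun τ τ' ↦ φ τ > φ τ' := by
    rw [List.pairwise_reverse, List.pairwise_ofFn]
    exact fun i j hij ↦ by simpa using hij
  rw [List.pairwise_map]
  constructor
  · exact fun h ↦ hfull.sublist h
  · intro h
    have : IsStrictOrder (reflections b) fun τ τ' ↦ φ τ > φ τ' :=
      { irrefl := fun τ ↦ lt_irrefl (φ τ)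
        trans := fun _ _ _ h1 h2 ↦ lt_trans h2 h1 }
    refine List.sublist_of_pairwise_of_subset h hfull fun τ _ ↦ ?_
    simpa using ⟨φ τ, φ.symm_apply_apply τ⟩

lemma IsMonotoneOnSystems.existsUnique_decreasing (hφ : IsMonotoneOnSystems b φ)
    (u v : P.weylGroup) : ∃! l, IsPath b u l v ∧ (l.map φ).Pairwise (· > ·) := by
  classical
  have h := hφ.pathCount_eq_one u v
  unfold pathCount at h
  rw [List.countP_eq_length_filter, List.length_eq_one_iff] at h
  obtain ⟨l, hl⟩ := h
  have key : ∀ l', IsPath b u l' v ∧ (l'.map φ).Pairwise (· > ·) ↔ l' = l := by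
    intro l'
    rw [← List.mem_singleton, ← hl, List.mem_filter, List.mem_sublists, sublist_reverse_ofFn_iff,
      decide_eq_true_iff, and_comm]
  exact ⟨l, (key l).mpr rfl, fun l' hl' ↦ (key l').mp hl'⟩

lemma pairwise_map_rev_iff {l : List (reflections b)} :
    (l.map (φ.trans Fin.revPerm)).Pairwise (· > ·) ↔ (l.map φ).Pairwise (· < ·) := by
  rw [List.pairwise_map, List.pairwise_map]
  simp

lemma IsMonotoneOnSystems.existsUnique_increasing (hφ : IsMonotoneOnSystems b φ)
    (u v : P.weylGroup) : ∃! l, IsPath b u l v ∧ (l.map φ).Pairwise (· < ·) := by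
  simpa only [pairwise_map_rev_iff] using
    (isMonotoneOnSystems_rev hφ).existsUnique_decreasing u v

end Uniqueness

section Shortest

lemma pathDist_le {u v : P.weylGroup} {l : List (reflections b)} (h : IsPath b u l v) :
    pathDist b u v ≤ l.length :=
  Nat.sInf_le ⟨l, h, rfl⟩

lemma IsMonotoneOnSystems.exists_shortest (hφ : IsMonotoneOnSystems b φ) (u v : P.weylGroup) :
    ∃ l, IsPath b u l v ∧ l.length = pathDist b u v := by
  obtain ⟨l, hl, -⟩ := hφ.existsUnique_increasing u v
  exact Nat.sInf_mem (s := {n | ∃ l, IsPath b u l v ∧ l.length = n}) ⟨_, l, hl.1, rfl⟩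

/-- A two-step path without increasing labels can be replaced by a smaller one, or is a cycle. -/
lemma IsMonotoneOnSystems.exists_exchange (hφ : IsMonotoneOnSystems b φ) {u v : P.weylGroup}
    {τ τ' : reflections b} (hne : τ ≠ τ') (hp : IsPath b u [τ, τ'] v) (hlt : ¬ φ τ < φ τ') :
    ∃ σ σ', IsPath b u [σ, σ'] v ∧ φ σ < φ τ := by
  obtain ⟨x, hx, rfl⟩ := exists_toRefl b τ
  obtain ⟨y, hy, rfl⟩ := exists_toRefl b τ'
  obtain ⟨k, γ, hγ, ⟨i, hi, rfl⟩, ⟨j, hj, rfl⟩, -⟩ :=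
    exists_isRankTwoSystem_mem hx hy fun he ↦ hne (by rw [he])
  have hij : i ≠ j := fun he ↦ hne (by rw [he])
  rcases hφ k γ hγ with hm | hm
  · have hji : j < i := by
      by_contra hc
      exact hlt (hm hi hj (by lia))
    obtain ⟨i', j', h1, h2, h3, h4⟩ := hγ.exists_increasing_path hi hji hp
    exact ⟨_, _, h4, hm (Set.mem_Iio.mpr (by lia)) hi h3⟩
  · have hji : i < j := by
      by_contra hc
      exact hlt (hm hj hi (by lia))
    obtain ⟨i', j', h1, h2, h3, h4⟩ := hγ.exists_decreasing_path hj hji hp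
    exact ⟨_, _, h4, hm hi h2 h3⟩

/-- Take a shortest path with lexicographically least labels. Where the labels fail to increase, an
immediate repetition could be deleted, contradicting shortness, and any other pair could be
exchanged, contradicting lexicographic minimality. -/
lemma IsMonotoneOnSystems.exists_minimal (hφ : IsMonotoneOnSystems b φ) (u v : P.weylGroup) :
    ∃ l, IsPath b u l v ∧ l.length = pathDist b u v ∧ (l.map φ).Pairwise (· < ·) ∧
      ∀ l', IsPath b u l' v → l'.length = pathDist b u v → l.map φ ≤ l'.map φ := by
  have : Finite (reflections b) := .of_equiv _ φ.symm
  obtain ⟨l, ⟨hl, hlen⟩, hmin⟩ := Set.exists_min_image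
    {l | IsPath b u l v ∧ l.length = pathDist b u v} (List.map φ)
    ((List.finite_length_eq (reflections b) (pathDist b u v)).subset fun l hl ↦ hl.2)
    (hφ.exists_shortest u v)
  refine ⟨l, hl, hlen, ?_, fun l' h1 h2 ↦ hmin l' ⟨h1, h2⟩⟩
  rw [List.pairwise_map]
  have : IsTrans (reflections b) fun τ τ' ↦ φ τ < φ τ' := ⟨fun _ _ _ h1 h2 ↦ lt_trans h1 h2⟩
  rw [← List.isChain_iff_pairwise, List.isChain_iff_forall_rel_of_append_cons_cons]
  intro τ τ' l₁ l₂ hsplit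
  by_contra hlt
  subst hsplit
  have hassoc : l₁ ++ τ :: τ' :: l₂ = l₁ ++ ([τ, τ'] ++ l₂) := rfl
  rw [hassoc, isPath_append_iff, isPath_append_iff] at hl
  obtain ⟨h1, h2, h3⟩ := hl
  by_cases hne : τ = τ'
  · subst hne
    have hw : walk b (walk b u l₁) [τ, τ] = walk b u l₁ := by
      rw [walk_cons, walk_cons, walk_nil, ← mul_assoc, mul_self_of_mem_reflections b τ.2, one_mul]
    have := pathDist_le ((isPath_append_iff b).mpr ⟨h1, hw ▸ h3⟩)
    rw [← hlen] at this
    simp at this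
  · obtain ⟨σ, σ', h4, h5⟩ := hφ.exists_exchange hne h2 hlt
    have hpath : IsPath b u (l₁ ++ ([σ, σ'] ++ l₂)) v := by
      rw [isPath_append_iff, isPath_append_iff, ← h4.eq_walk]
      exact ⟨h1, h4, h3⟩
    have h6 := hmin _ ⟨hpath, by rw [← hlen]; simp⟩
    refine absurd h6 (not_le.mpr ?_)
    simp only [hassoc, List.map_append]
    exact List.append_left_lt (List.Lex.rel h5)

/-- Equal lengths matter: a proper prefix remains lexicographically smaller after the letters are
reversed. -/
lemma map_rev_lt_map_rev {l l' : List (Fin n)} (hlen : l.length = l'.length)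
    (h : List.Lex (· < ·) l l') : List.Lex (· < ·) (l'.map Fin.rev) (l.map Fin.rev) := by
  induction h with
  | nil => simp at hlen
  | cons _ ih => exact .cons (ih (by simpa using hlen))
  | rel h => exact .rel (Fin.rev_lt_rev.mpr h)

lemma le_of_map_rev_le {l l' : List (Fin n)} (hlen : l.length = l'.length)
    (h : l.map Fin.rev ≤ l'.map Fin.rev) : l' ≤ l := by
  rw [← not_lt] at h ⊢
  exact fun hlt ↦ h (map_rev_lt_map_rev hlen hlt)

lemma IsMonotoneOnSystems.increasing_spec (hφ : IsMonotoneOnSystems b φ) {u v : P.weylGroup}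
    {l : List (reflections b)} (hl : IsPath b u l v) (hinc : (l.map φ).Pairwise (· < ·)) :
    l.length = pathDist b u v ∧
      ∀ l', IsPath b u l' v → l'.length = pathDist b u v → l.map φ ≤ l'.map φ := by
  obtain ⟨l₀, h1, h2, h3, h4⟩ := hφ.exists_minimal u v
  rw [(hφ.existsUnique_increasing u v).unique ⟨hl, hinc⟩ ⟨h1, h3⟩]
  exact ⟨h2, h4⟩

lemma IsMonotoneOnSystems.decreasing_spec (hφ : IsMonotoneOnSystems b φ) {u v : P.weylGroup}
    {l : List (reflections b)} (hl : IsPath b u l v) (hdec : (l.map φ).Pairwise (· > ·)) :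
    l.length = pathDist b u v ∧
      ∀ l', IsPath b u l' v → l'.length = pathDist b u v → l'.map φ ≤ l.map φ := by
  obtain ⟨h1, h2⟩ := (isMonotoneOnSystems_rev hφ).increasing_spec hl (by
    rw [List.pairwise_map] at hdec ⊢
    simpa using hdec)
  refine ⟨h1, fun l' h3 h4 ↦ le_of_map_rev_le (by simp [h1, h4]) ?_⟩
  have h5 := h2 l' h3 h4
  rwa [Equiv.coe_trans, ← List.map_map, ← List.map_map] at h5

end Shortest

section Product

variable (𝕜 : Type*) [Field 𝕜]

/-- Each contributing path is decreasing, so its exponent is the distance to its end, and exactly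
one path ends at each `v`. -/
lemma IsMonotoneOnSystems.pathSum_eq (hφ : IsMonotoneOnSystems b φ) (u : P.weylGroup) :
    pathSum b 𝕜 u (List.ofFn φ.symm).reverse =
      ∑ᶠ v : P.weylGroup, Finsupp.single v ((X : 𝕜[X]) ^ pathDist b u v) := by
  classical
  have := Fintype.ofFinite P.weylGroup
  rw [finsum_eq_sum_of_fintype]
  ext1 v
  have hsum : ∀ L : List (List (reflections b)),
      (∀ l ∈ L, (l.map φ).Pairwise (· > ·)) → (L.map (pathTerm b 𝕜 u)).sum v =
        (L.countP fun l ↦ IsPath b u l v) • (X : 𝕜[X]) ^ pathDist b u v := by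
    intro L hL
    induction L with
    | nil => simp
    | cons l L ih =>
      have h1 : pathTerm b 𝕜 u l v = if IsPath b u l v then X ^ pathDist b u v else 0 := by
        unfold pathTerm
        by_cases h : IsPath b u l v
        · have h2 := (hφ.decreasing_spec h (hL l (by simp))).1
          have h3 := h.eq_walk
          rw [← h2, if_pos h]
          subst h3
          rw [if_pos h, Finsupp.single_eq_same]
        · rw [if_neg h]
          split_ifs with h2
          · rw [Finsupp.single_apply, if_neg (by rintro rfl; exact h h2)]
          · rfl
      rw [List.map_cons, List.sum_cons, Finsupp.add_apply, ih fun l hl ↦ hL l (by simp [hl]), h1,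
        List.countP_cons, add_smul, add_comm]
      congr 1
      by_cases h : IsPath b u l v <;> simp [h]
  have hcount := hφ.pathCount_eq_one u v
  unfold pathCount at hcount
  rw [pathSum, hsum _ fun l hl ↦ sublist_reverse_ofFn_iff.mp (List.mem_sublists.mp hl), hcount,
    one_smul, Finsupp.finsetSum_apply]
  simp [Finsupp.single_apply]

end Product

end QuantumBruhat

end

theorem theorem6p4 {ι M N : Type*} [Finite ι] [AddCommGroup M] [Module ℝ M]
    [AddCommGroup N] [Module ℝ N] (P : RootPairing ι ℝ M N) [P.IsRootSystem]
    [P.IsCrystallographic] [P.IsReduced] (b : P.Base)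
    (𝕜 : Type*) [Field 𝕜] [CharZero 𝕜]
    (w₀ : P.weylGroup) (hw₀ : ∀ w, QuantumBruhat.len b w ≤ QuantumBruhat.len b w₀)
    (φ : QuantumBruhat.reflections b ≃ Fin (QuantumBruhat.len b w₀))
    (hφ : QuantumBruhat.IsReflectionOrdering b φ) :
    -- existence and uniqueness of label-increasing and label-decreasing paths
    (∀ u v : P.weylGroup,
      (∃! l, QuantumBruhat.IsPath b u l v ∧ (l.map φ).Pairwise (· < ·)) ∧
      (∃! l, QuantumBruhat.IsPath b u l v ∧ (l.map φ).Pairwise (· > ·))) ∧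
    -- these paths are shortest, and lexicographically extremal among the shortest paths
    (∀ (u v : P.weylGroup) (l : List (QuantumBruhat.reflections b)),
      QuantumBruhat.IsPath b u l v →
      ((l.map φ).Pairwise (· < ·) →
        l.length = QuantumBruhat.pathDist b u v ∧
        ∀ l', QuantumBruhat.IsPath b u l' v → l'.length = QuantumBruhat.pathDist b u v →
          l.map φ ≤ l'.map φ) ∧
      ((l.map φ).Pairwise (· > ·) →
        l.length = QuantumBruhat.pathDist b u v ∧
        ∀ l', QuantumBruhat.IsPath b u l' v → l'.length = QuantumBruhat.pathDist b u v →
          l'.map φ ≤ l.map φ)) ∧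
    -- the ordered product of the operators `R_τ`
    (∀ u : P.weylGroup,
      (List.ofFn fun i ↦ QuantumBruhat.opR b 𝕜 (φ.symm i)).prod (Finsupp.single u 1) =
        ∑ᶠ v : P.weylGroup,
          Finsupp.single v ((Polynomial.X : Polynomial 𝕜) ^ QuantumBruhat.pathDist b u v)) := by
  have hmono := hφ.isMonotoneOnSystems
  refine ⟨fun u v ↦ ⟨hmono.existsUnique_increasing u v, hmono.existsUnique_decreasing u v⟩,
    fun u v l hl ↦ ⟨hmono.increasing_spec hl, hmono.decreasing_spec hl⟩, fun u ↦ ?_⟩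
  rw [← hmono.pathSum_eq 𝕜 u, ← QuantumBruhat.prod_opR_single, List.map_ofFn]
  rfl
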